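/- **Conventions.** For real tensors $\mathcal A\in\mathbb R^{I\times J\times I_3}$ and $\mathcal B\in\mathbb R^{J\times K\times I_3}$ the t-product is $(\mathcal A*\mathcal B)(i,k,:)=\sum_{j}\mathcal A(i,j,:)\bullet\mathcal B(j,k,:)$, where $\bullet$ is circular convolution of vectors of length $I_3$. The transpose $\mathcal A^{\top}$ is obtained by transposing every frontal slice and reversing the order of the slices $2,\dots,I_3$. The identity tensor $\mathcal I$ has the identity matrix as first frontal slice and zeros elsewhere; inverses and orthogonal tensors are understood with respect to $*$ and $\mathcal I$. $\widehat{\mathbf A}^{(k)}$, $1\le k\le I_3$, are the frontal slices of the discrete Fourier transform of $\mathcal A$ along the third mode. The tubal rank of $\mathcal A$ is $\max_k\operatorname{rank}\widehat{\mathbf A}^{(k)}$; $\sigma_{\min}(\mathcal A)$ and $\sigma_{\max}(\mathcal A)$ are the smallest nonzero and the largest singular value of all the matrices $\widehat{\mathbf A}^{(k)}$, and $\kappa=\sigma_{\max}(\mathcal X_\star)/\sigma_{\min}(\mathcal X_\star)$. A t-SVD is a factorization $\mathcal A=\mathcal U*\mathit\Sigma*\mathcal V^{\top}$ with $\mathcal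 U,\mathcal V$ orthogonal and $\mathit\Sigma$ having diagonal frontal slices such that every $\widehat{\mathbf\Sigma}^{(k)}$ has nonnegative, nonincreasing diagonal entries; in a skinny t-SVD with parameter $R$, $\mathcal U\in\mathbb R^{I_1\times R\times I_3}$, $\mathit\Sigma\in\mathbb R^{R\times R\times I_3}$, $\mathcal V\in\mathbb R^{I_2\times R\times I_3}$ and $\mathcal U^{\top}*\mathcal U=\mathcal V^{\top}*\mathcal V=\mathcal I$. Norms: $\|\mathcal A\|_{\mathrm F}=(\sum a_{ijt}^2)^{1/2}$, $\|\mathcal A\|_\infty=\max|a_{ijt}|$, $\|\mathcal A\|_{2,\infty}=\max_i(\sum_{j,t}a_{ijt}^2)^{1/2}$. Soft thresholding is $[\mathrm T_\zeta(\mathcal A)]_{ijt}=\operatorname{sign}(a_{ijt})\max(0,|a_{ijt}|-\zeta)$. The top-$R$ approximation is $\mathcal D_R(\mathcal A)=[\mathcal U_R*\mathit\Sigma_R^{1/2},\,\mathcal V_R*\mathit\Sigma_R^{1/2}]$ with $\mathcal U_R=\mathcal U(:,1{:}R,:)$, $\mathit\Sigma_R=\mathit\Sigma(1{:}R,1{:}R,:)$,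 $\mathcal V_R=\mathcal V(:,1{:}R,:)$ for a t-SVD of $\mathcal A$; the square root is taken in the Fourier domain. **Algorithm (RTPCA-SGD).** Given $\mathcal Y$, $R$, thresholds $(\zeta_k)_{k\ge0}$ and a step size $\eta$, put $\mathcal S_0=\mathrm T_{\zeta_0}(\mathcal Y)$, $[\mathcal L_0,\mathcal R_0]=\mathcal D_R(\mathcal Y-\mathcal S_0)$ and, for $k\ge0$, $$\mathcal S_{k+1}=\mathrm T_{\zeta_{k+1}}(\mathcal Y-\mathcal L_k*\mathcal R_k^{\top}),$$ $$\mathcal L_{k+1}=\mathcal L_k-\eta(\mathcal L_k*\mathcal R_k^{\top}+\mathcal S_{k+1}-\mathcal Y)*\mathcal R_k*(\mathcal R_k^{\top}*\mathcal R_k)^{-1},$$ $$\mathcal R_{k+1}=\mathcal R_k-\eta(\mathcal L_k*\mathcal R_k^{\top}+\mathcal S_{k+1}-\mathcal Y)^{\top}*\mathcal L_k*(\mathcal L_k^{\top}*\mathcal L_k)^{-1};$$ write $\mathcal X_k=\mathcal L_k*\mathcal R_k^{\top}$. **Theorem (Guaranteed recovery).** Let $\mathcal X_\star,\mathcal S_\star\in\mathbb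 R^{I_1\times I_2\times I_3}$ and $\mathcal Y=\mathcal X_\star+\mathcal S_\star$. Suppose that $\mathcal X_\star$ has tubal rank $R\ge1$, that all Fourier-domain frontal slices $\widehat{\mathbf X}_\star^{(k)}$ have the same rank $R$ (equivalently, the middle factor of its skinny t-SVD is invertible), and that $\mathcal X_\star$ is $\mu$-incoherent for some $\mu\ge1$: it has a skinny t-SVD $\mathcal X_\star=\mathcal U_\star*\mathit\Sigma_\star*\mathcal V_\star^{\top}$ with parameter $R$ such that $\|\mathcal U_\star\|_{2,\infty}\le\sqrt{\mu R/I_1}$ and $\|\mathcal V_\star\|_{2,\infty}\le\sqrt{\mu R/I_2}$. Suppose that $\mathcal S_\star$ is $\alpha$-sparse, i.e. at most a fraction $\alpha$ of the entries of each slice $\mathcal S_\star(i_1,:,:)$, $\mathcal S_\star(:,i_2,:)$, $\mathcal S_\star(:,:,i_3)$ is nonzero, with $$\alpha\le\frac1{10^4\,\mu\,R^{1.5}I_3^{1.5}\kappa}.$$ Let $\|\mathcal X_\star\|_\infty\le\zeta_0\le2\|\mathcal X_\star\|_\infty$, $\zeta_1=\frac{3}{\sqrt{I_1I_2}}\mu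 R\,\sigma_{\min}(\mathcal X_\star)$, $\zeta_{k+1}=\tau\zeta_k$ for $k\ge1$, $\eta\in[\frac14,\frac23]$ and $\tau=1-0.6\eta$. Then, for every choice of the t-SVD in the initialization, all the inverses in the algorithm exist and the iterates satisfy $$\|\mathcal X_k-\mathcal X_\star\|_{\mathrm F}\le\frac{0.03}{\sqrt{I_3}}\,\tau^k\sigma_{\min}(\mathcal X_\star),\qquad \|\mathcal X_k-\mathcal X_\star\|_\infty\le\frac{3}{\sqrt{I_1I_2}}\,\mu R\,\tau^k\sigma_{\min}(\mathcal X_\star)\qquad(k\ge0),$$ $$\|\mathcal S_k-\mathcal S_\star\|_\infty\le\frac{6}{\sqrt{I_1I_2}}\,\mu R\,\tau^{k-1}\sigma_{\min}(\mathcal X_\star)\qquad(k\ge1),$$ and $\operatorname{supp}(\mathcal S_k)\subseteq\operatorname{supp}(\mathcal S_\star)$ for all $k\ge0$. -/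

import Mathlib

namespace RTPCA

/-- Real order-3 tensors of size `I × J × n`. The first two indices are counted from `0`; the third
one is read cyclically, so that `A i j 0` belongs to the first frontal slice. -/
abbrev Tensor (I J n : ℕ) : Type := Fin I → Fin J → ZMod n → ℝ

section Algebra

variable {I J K n : ℕ} [NeZero n]

/-- The t-product: `(A ∗ B)(i, j, :)` is the sum over `k` of the circular convolutions of the tubes
`A(i, k, :)` and `B(k, j, :)`. -/
def tProd (A : Tensor I J n) (B : Tensor J K n) : Tensor I K n :=
  fun i j t => ∑ k, ∑ s, A i k s * B k j (t - s)

infixl:70 " ∗ₜ " => tProd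

/-- The transpose: every frontal slice is transposed and the order of the frontal slices
`2, …, n` is reversed. -/
def tTranspose (A : Tensor I J n) : Tensor J I n := fun j i t => A i j (-t)

postfix:max "ᵗ" => tTranspose

/-- The identity tensor: its first frontal slice is the identity matrix, the others vanish. -/
def tId (I n : ℕ) [NeZero n] : Tensor I I n := fun i j t => if i = j ∧ t = 0 then 1 else 0

/-- `B` is a two-sided inverse of `A` for the t-product. -/
def IsTInverse (A B : Tensor I I n) : Prop := A ∗ₜ B = tId I n ∧ B ∗ₜ A = tId I n

/-- `A` is invertible for the t-product. -/
def TInvertible (A : Tensor I I n) : Prop := ∃ B, IsTInverse A B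

open Classical in
/-- The inverse tensor of `A` (the zero tensor if `A` is not invertible). -/
noncomputable def tInv (A : Tensor I I n) : Tensor I I n :=
  if h : TInvertible A then h.choose else 0

/-- Orthogonal tensors. -/
def IsOrthogonal (A : Tensor I I n) : Prop := Aᵗ ∗ₜ A = tId I n ∧ A ∗ₜ Aᵗ = tId I n

/-- A tensor is f-diagonal if all its frontal slices are diagonal. -/
def FDiagonal (A : Tensor I J n) : Prop :=
  ∀ (i : Fin I) (j : Fin J) (t : ZMod n), (i : ℕ) ≠ (j : ℕ) → A i j t = 0

/-- The `k`-th frontal slice of the discrete Fourier transform of `A` along the third mode. -/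
noncomputable def fourierSlice (A : Tensor I J n) (k : ZMod n) : Matrix (Fin I) (Fin J) ℂ :=
  Matrix.of fun i j => ZMod.dft (fun t => (A i j t : ℂ)) k

/-- The diagonal entries of all Fourier-domain frontal slices are nonnegative reals. -/
def FourierDiagNonneg (A : Tensor I J n) : Prop :=
  ∀ (k : ZMod n) (i : Fin I) (j : Fin J), (i : ℕ) = (j : ℕ) →
    0 ≤ (fourierSlice A k i j).re ∧ (fourierSlice A k i j).im = 0

/-- Middle factor of a t-SVD: an f-diagonal tensor each of whose Fourier-domain frontal slices has
nonnegative diagonal entries in nonincreasing order (as the middle factor of a matrix SVD). -/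
structure IsSingularTensor (D : Tensor I J n) : Prop where
  fDiagonal : FDiagonal D
  nonneg : FourierDiagNonneg D
  antitone : ∀ (k : ZMod n) (i i' : Fin I) (j j' : Fin J), (i : ℕ) = (j : ℕ) →
    (i' : ℕ) = (j' : ℕ) → (i : ℕ) ≤ (i' : ℕ) →
      (fourierSlice D k i' j').re ≤ (fourierSlice D k i j).re

/-- `A = U ∗ D ∗ Vᵗ` is a (full) t-SVD of `A`. -/
structure IsTSVD (A : Tensor I J n) (U : Tensor I I n) (D : Tensor I J n) (V : Tensor J J n) :
    Prop where
  left : IsOrthogonal U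
  right : IsOrthogonal V
  middle : IsSingularTensor D
  eq : A = U ∗ₜ D ∗ₜ Vᵗ

/-- `A = U ∗ D ∗ Vᵗ` is a skinny t-SVD of `A` with parameter `R`. -/
structure IsSkinnyTSVD {R : ℕ} (A : Tensor I J n) (U : Tensor I R n) (D : Tensor R R n)
    (V : Tensor J R n) : Prop where
  left : Uᵗ ∗ₜ U = tId R n
  right : Vᵗ ∗ₜ V = tId R n
  middle : IsSingularTensor D
  eq : A = U ∗ₜ D ∗ₜ Vᵗ

/-- `T = D ^ (1/2)` for an f-diagonal tensor `D` with nonnegative Fourier-domain diagonal: `T` is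
the f-diagonal tensor with nonnegative Fourier-domain diagonal such that `T ∗ T = D`. -/
structure IsTSqrt {R : ℕ} (D T : Tensor R R n) : Prop where
  fDiagonal : FDiagonal T
  nonneg : FourierDiagNonneg T
  sq : T ∗ₜ T = D

/-- `[L, M]` is a top-`R` tensor approximation of `A`: for some t-SVD `A = U ∗ D ∗ Vᵗ`, with
truncations `U_R = U(:, 1:R, :)`, `D_R = D(1:R, 1:R, :)`, `V_R = V(:, 1:R, :)`, one has
`L = U_R ∗ D_R ^ (1/2)` and `M = V_R ∗ D_R ^ (1/2)`. -/
def IsTopApprox (R : ℕ) (A : Tensor I J n) (L : Tensor I R n) (M : Tensor J R n) : Prop :=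
  ∃ (hI : R ≤ I) (hJ : R ≤ J) (U : Tensor I I n) (D : Tensor I J n) (V : Tensor J J n)
    (T : Tensor R R n),
    IsTSVD A U D V ∧
    IsTSqrt (fun r r' t => D (Fin.castLE hI r) (Fin.castLE hJ r') t) T ∧
    L = (fun i r t => U i (Fin.castLE hI r) t : Tensor I R n) ∗ₜ T ∧
    M = (fun j r t => V j (Fin.castLE hJ r) t : Tensor J R n) ∗ₜ T

/-- The `k`-th entry of the multi-rank: the rank of the `k`-th Fourier-domain frontal slice. -/
noncomputable def multiRank (A : Tensor I J n) (k : ZMod n) : ℕ := (fourierSlice A k).rank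

/-- The tubal rank: the largest entry of the multi-rank. -/
noncomputable def tubalRank (A : Tensor I J n) : ℕ := Finset.univ.sup (multiRank A)

/-- The nonzero singular values of all Fourier-domain frontal slices of `A`. -/
def nonzeroSingularValues (A : Tensor I J n) : Set ℝ :=
  {s | s ≠ 0 ∧ ∃ (k : ZMod n) (i : ℕ),
    s = (Matrix.toEuclideanLin (fourierSlice A k)).singularValues i}

/-- The smallest nonzero singular value of the Fourier-domain frontal slices. -/
noncomputable def sigmaMin (A : Tensor I J n) : ℝ := sInf (nonzeroSingularValues A)

/-- The largest singular value of the Fourier-domain frontal slices. -/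
noncomputable def sigmaMax (A : Tensor I J n) : ℝ := sSup (nonzeroSingularValues A)

/-- The condition number. -/
noncomputable def condNumber (A : Tensor I J n) : ℝ := sigmaMax A / sigmaMin A

/-- The Frobenius norm. -/
noncomputable def frobNorm (A : Tensor I J n) : ℝ := √(∑ i, ∑ j, ∑ t, A i j t ^ 2)

/-- The largest absolute value of an entry. -/
noncomputable def infNorm (A : Tensor I J n) : ℝ :=
  ⨆ p : Fin I × Fin J × ZMod n, |A p.1 p.2.1 p.2.2|

/-- The `ℓ_{2,∞}` norm: the largest Euclidean norm of a horizontal slice. -/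
noncomputable def twoInfNorm (A : Tensor I J n) : ℝ := ⨆ i, √(∑ j, ∑ t, A i j t ^ 2)

/-- The support: the set of indices of nonzero entries. -/
def supp (A : Tensor I J n) : Set (Fin I × Fin J × ZMod n) := {p | A p.1 p.2.1 p.2.2 ≠ 0}

/-- The tensor `μ`-incoherence conditions, with a skinny t-SVD of parameter `R`. -/
def Incoherent (R : ℕ) (μ : ℝ) (A : Tensor I J n) : Prop :=
  ∃ (U : Tensor I R n) (D : Tensor R R n) (V : Tensor J R n), IsSkinnyTSVD A U D V ∧
    twoInfNorm U ≤ √(μ * R / I) ∧ twoInfNorm V ≤ √(μ * R / J)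

/-- `α`-t-sparsity: at most a fraction `α` of the entries of each horizontal, lateral and frontal
slice is nonzero. -/
def TSparse (α : ℝ) (S : Tensor I J n) : Prop :=
  (∀ i, (({p : Fin J × ZMod n | S i p.1 p.2 ≠ 0}.ncard : ℕ) : ℝ) ≤ α * (J * n)) ∧
  (∀ j, (({p : Fin I × ZMod n | S p.1 j p.2 ≠ 0}.ncard : ℕ) : ℝ) ≤ α * (I * n)) ∧
  (∀ t, (({p : Fin I × Fin J | S p.1 p.2 t ≠ 0}.ncard : ℕ) : ℝ) ≤ α * (I * J))

/-- Entrywise soft thresholding with threshold `z`. -/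
noncomputable def softThreshold (z : ℝ) (A : Tensor I J n) : Tensor I J n :=
  fun i j t => Real.sign (A i j t) * max 0 (|A i j t| - z)

/-- `(L k, M k, S k)`, `k = 0, 1, 2, …`, are the iterates of RTPCA-SGD for the observed tensor `Y`
with rank parameter `R`, thresholding values `ζ 0, ζ 1, …` and step size `η`. -/
structure IsRTPCASGD (R : ℕ) (Y : Tensor I J n) (ζ : ℕ → ℝ) (η : ℝ)
    (L : ℕ → Tensor I R n) (M : ℕ → Tensor J R n) (S : ℕ → Tensor I J n) : Prop where
  init_sparse : S 0 = softThreshold (ζ 0) Y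
  init_lowRank : IsTopApprox R (Y - S 0) (L 0) (M 0)
  step_sparse : ∀ k, S (k + 1) = softThreshold (ζ (k + 1)) (Y - L k ∗ₜ (M k)ᵗ)
  step_left : ∀ k, L (k + 1) =
    L k - η • ((L k ∗ₜ (M k)ᵗ + S (k + 1) - Y) ∗ₜ M k ∗ₜ tInv ((M k)ᵗ ∗ₜ M k))
  step_right : ∀ k, M (k + 1) =
    M k - η • ((L k ∗ₜ (M k)ᵗ + S (k + 1) - Y)ᵗ ∗ₜ L k ∗ₜ tInv ((L k)ᵗ ∗ₜ L k))

end Algebra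

end RTPCA

open RTPCA

/-! `blockCirc` turns the t-product, transpose and inverse into those of real matrices, so the
algorithm becomes an iteration on ordinary matrices of rank `R * n`. Rows and columns of a block
circulant matrix are rearranged horizontal and lateral slices, so incoherence, sparsity and
entrywise bounds carry over; the Frobenius norm gains a factor √n, and Parseval relates operator
norms to the Fourier slices.

Write X = L Mᵀ, Δ = X - X⋆, S for the error of the sparse part and E = Δ + S. Let P, Q be the
orthogonal projections onto the column and row space of X and G its pseudoinverse. One step is X ↦ X
- ηEQ - ηPE + η²EGE (`blockCirc_update`). This involves the factors only through X, so they need not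
be aligned with factors of X⋆. With t = τ^k, σ = `sigmaMin`, u = √(μR/I), v = √(μR/J), the induction
propagates `ErrorBound`: ‖Δ‖_F ≤ 0.03tσ, rows of Δ at most 0.5utσ, columns at most 0.5vtσ.

Frobenius norm: the part linear in Δ is (1-η)Δ - ηPΔQ, of norm at most (1-η)‖Δ‖_F when η ≤ 2/3, plus
η(1-P)Δ(1-Q), which is quadratic in Δ. Rows: Δ - ηΔQ = (1-η)Δ + ηΔ(1-Q), where Δ(1-Q) lies in the
column space of X⋆ and inherits its incoherence; the other terms are small because P and Q stay
incoherent. The gap between 1 - η and 1 - 0.6η absorbs everything else.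

Sparse part: the three bounds give |Δ| ≤ 3uvtσ entrywise (`LowRankPair.abs_apply_le`), which is the
next threshold. Hence thresholding creates no new support and leaves an error of at most 6uvtσ;
sparsity and the Schur test then make ‖S‖ small. At the start, X₀ is a compression of X⋆ + S by P
and by Q and lies within ‖S‖ of it (`IsTopApprox.blockCirc_spec`); the incoherence of P and Q
follows from two coupled inequalities. -/

namespace RTPCA

section

open Matrix
open scoped Matrix.Norms.L2Operator

/-! ### Operator, Frobenius and row norms of real matrices. -/

section MatrixNorms

set_option linter.unusedSectionVars false

variable {m n l : Type*} [Fintype m] [Fintype n] [Fintype l] [DecidableEq m] [DecidableEq n]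
  [DecidableEq l]

theorem opNorm_transpose (A : Matrix m n ℝ) : ‖Aᵀ‖ = ‖A‖ := by
  rw [← conjTranspose_eq_transpose_of_trivial, l2_opNorm_conjTranspose]

theorem opNorm_le_of_forall_mulVec {A : Matrix m n ℝ} {c : ℝ} (hc : 0 ≤ c)
    (h : ∀ x : EuclideanSpace ℝ n, ‖WithLp.toLp 2 (A *ᵥ x)‖ ≤ c * ‖x‖) : ‖A‖ ≤ c := by
  rw [l2_opNorm_def]
  exact ContinuousLinearMap.opNorm_le_bound _ hc fun x => h x

theorem opNorm_mul_le_of_le {A : Matrix m n ℝ} {B : Matrix n l ℝ} {a b : ℝ} (hA : ‖A‖ ≤ a)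
    (hB : ‖B‖ ≤ b) : ‖A * B‖ ≤ a * b :=
  (l2_opNorm_mul A B).trans
    (mul_le_mul hA hB (norm_nonneg _) ((norm_nonneg _).trans hA))

theorem opNorm_le_one_of_transpose_mul_self {U : Matrix m n ℝ} (h : Uᵀ * U = 1) : ‖U‖ ≤ 1 := by
  refine opNorm_le_of_forall_mulVec zero_le_one fun x => ?_
  rw [one_mul]
  refine le_of_sq_le_sq (le_of_eq ?_) (norm_nonneg _)
  rw [EuclideanSpace.real_norm_sq_eq, EuclideanSpace.real_norm_sq_eq]
  have h1 : (U *ᵥ x.ofLp) ⬝ᵥ (U *ᵥ x.ofLp) = x.ofLp ⬝ᵥ x.ofLp := by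
    rw [dotProduct_mulVec, ← mulVec_transpose, mulVec_mulVec, h, one_mulVec]
  simpa [dotProduct, sq] using h1

theorem opNorm_le_one_of_projection {P : Matrix m m ℝ} (hs : Pᵀ = P) (hi : P * P = P) :
    ‖P‖ ≤ 1 := by
  have h := l2_opNorm_conjTranspose_mul_self P
  -- The C⋆-identity now reads ‖P‖ = ‖P‖².
  rw [conjTranspose_eq_transpose_of_trivial, hs, hi] at h
  nlinarith [norm_nonneg P, sq_nonneg (‖P‖ - 1)]

theorem transpose_one_sub {P : Matrix m m ℝ} (hs : Pᵀ = P) : (1 - P)ᵀ = 1 - P := by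
  rw [transpose_sub, transpose_one, hs]

theorem one_sub_mul_one_sub {P : Matrix m m ℝ} (hi : P * P = P) :
    (1 - P) * (1 - P) = 1 - P := by
  rw [sub_mul, mul_sub, mul_sub, hi]; simp

theorem opNorm_one_sub_le_one {P : Matrix m m ℝ} (hs : Pᵀ = P) (hi : P * P = P) :
    ‖1 - P‖ ≤ 1 :=
  opNorm_le_one_of_projection (transpose_one_sub hs) (one_sub_mul_one_sub hi)

/-- The Euclidean norm of a row. -/
noncomputable def rowNorm (A : Matrix m n ℝ) (i : m) : ℝ := ‖WithLp.toLp 2 (A i)‖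

/-- The Frobenius norm of a matrix. -/
noncomputable def frob (A : Matrix m n ℝ) : ℝ :=
  ‖WithLp.toLp 2 (fun p : m × n => A p.1 p.2)‖

theorem rowNorm_nonneg (A : Matrix m n ℝ) (i : m) : 0 ≤ rowNorm A i := norm_nonneg _

theorem frob_nonneg (A : Matrix m n ℝ) : 0 ≤ frob A := norm_nonneg _

theorem rowNorm_sq (A : Matrix m n ℝ) (i : m) : rowNorm A i ^ 2 = ∑ j, A i j ^ 2 := by
  rw [rowNorm, EuclideanSpace.real_norm_sq_eq]

theorem frob_sq (A : Matrix m n ℝ) : frob A ^ 2 = ∑ i, ∑ j, A i j ^ 2 := by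
  rw [frob, EuclideanSpace.real_norm_sq_eq, Fintype.sum_prod_type]

theorem frob_sq_eq_sum_rowNorm_sq (A : Matrix m n ℝ) : frob A ^ 2 = ∑ i, rowNorm A i ^ 2 := by
  simp only [frob_sq, rowNorm_sq]

theorem frob_sq_eq_trace (A : Matrix m n ℝ) : frob A ^ 2 = (Aᵀ * A).trace := by
  rw [frob_sq, Finset.sum_comm]
  simp [trace, mul_apply, sq]

theorem rowNorm_add_le (A B : Matrix m n ℝ) (i : m) :
    rowNorm (A + B) i ≤ rowNorm A i + rowNorm B i :=
  norm_add_le (WithLp.toLp 2 (A i)) (WithLp.toLp 2 (B i))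

theorem rowNorm_sub_le (A B : Matrix m n ℝ) (i : m) :
    rowNorm (A - B) i ≤ rowNorm A i + rowNorm B i :=
  norm_sub_le (WithLp.toLp 2 (A i)) (WithLp.toLp 2 (B i))

theorem rowNorm_smul (c : ℝ) (A : Matrix m n ℝ) (i : m) :
    rowNorm (c • A) i = |c| * rowNorm A i :=
  norm_smul c (WithLp.toLp 2 (A i))

theorem frob_add_le (A B : Matrix m n ℝ) : frob (A + B) ≤ frob A + frob B :=
  norm_add_le (WithLp.toLp 2 (fun p : m × n => A p.1 p.2)) (WithLp.toLp 2 fun p => B p.1 p.2)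

theorem frob_sub_le (A B : Matrix m n ℝ) : frob (A - B) ≤ frob A + frob B :=
  norm_sub_le (WithLp.toLp 2 (fun p : m × n => A p.1 p.2)) (WithLp.toLp 2 fun p => B p.1 p.2)

theorem frob_smul (c : ℝ) (A : Matrix m n ℝ) : frob (c • A) = |c| * frob A :=
  norm_smul c (WithLp.toLp 2 (fun p : m × n => A p.1 p.2))

theorem frob_neg (A : Matrix m n ℝ) : frob (-A) = frob A :=
  norm_neg (WithLp.toLp 2 (fun p : m × n => A p.1 p.2))

theorem frob_transpose (A : Matrix m n ℝ) : frob Aᵀ = frob A := by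
  refine (sq_eq_sq₀ (frob_nonneg _) (frob_nonneg _)).1 ?_
  rw [frob_sq, frob_sq, Finset.sum_comm]
  rfl

theorem rowNorm_mul_le (A : Matrix m n ℝ) (B : Matrix n l ℝ) (i : m) :
    rowNorm (A * B) i ≤ rowNorm A i * ‖B‖ := by
  have h := l2_opNorm_mulVec Bᵀ (WithLp.toLp 2 (A i))
  rw [opNorm_transpose, mul_comm] at h
  have e : (A * B) i = Bᵀ *ᵥ (A i) := by
    rw [mulVec_transpose]; rfl
  rw [rowNorm, e]
  exact h

theorem rowNorm_mul_le_of_le {A : Matrix m n ℝ} {B : Matrix n l ℝ} {i : m} {a b : ℝ}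
    (hA : rowNorm A i ≤ a) (hB : ‖B‖ ≤ b) : rowNorm (A * B) i ≤ a * b :=
  (rowNorm_mul_le A B i).trans
    (mul_le_mul hA hB (norm_nonneg _) ((rowNorm_nonneg _ _).trans hA))

theorem frob_mul_le (A : Matrix m n ℝ) (B : Matrix n l ℝ) :
    frob (A * B) ≤ frob A * ‖B‖ := by
  refine le_of_sq_le_sq ?_ (mul_nonneg (frob_nonneg _) (norm_nonneg _))
  rw [mul_pow, frob_sq_eq_sum_rowNorm_sq, frob_sq_eq_sum_rowNorm_sq, Finset.sum_mul]
  refine Finset.sum_le_sum fun i _ => ?_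
  rw [← mul_pow]
  exact pow_le_pow_left₀ (rowNorm_nonneg _ _) (rowNorm_mul_le A B i) 2

theorem frob_mul_le' (A : Matrix m n ℝ) (B : Matrix n l ℝ) :
    frob (A * B) ≤ ‖A‖ * frob B := by
  rw [← frob_transpose, transpose_mul, mul_comm, ← opNorm_transpose A, ← frob_transpose B]
  exact frob_mul_le _ _

theorem frob_mul_le_of_le {A : Matrix m n ℝ} {B : Matrix n l ℝ} {a b : ℝ}
    (hA : frob A ≤ a) (hB : ‖B‖ ≤ b) : frob (A * B) ≤ a * b :=
  (frob_mul_le A B).trans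
    (mul_le_mul hA hB (norm_nonneg _) ((frob_nonneg _).trans hA))

theorem frob_mul_le_of_le' {A : Matrix m n ℝ} {B : Matrix n l ℝ} {a b : ℝ}
    (hA : ‖A‖ ≤ a) (hB : frob B ≤ b) : frob (A * B) ≤ a * b :=
  (frob_mul_le' A B).trans
    (mul_le_mul hA hB (frob_nonneg _) ((norm_nonneg _).trans hA))

theorem opNorm_le_frob (A : Matrix m n ℝ) : ‖A‖ ≤ frob A := by
  refine opNorm_le_of_forall_mulVec (frob_nonneg _) fun x => ?_
  refine le_of_sq_le_sq ?_ (mul_nonneg (frob_nonneg _) (norm_nonneg _))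
  rw [mul_pow, EuclideanSpace.real_norm_sq_eq, EuclideanSpace.real_norm_sq_eq, frob_sq,
    Finset.sum_mul]
  refine Finset.sum_le_sum fun i _ => ?_
  exact Finset.sum_mul_sq_le_sq_mul_sq Finset.univ (A i) x

theorem abs_mul_apply_le (A : Matrix m n ℝ) (B : Matrix n l ℝ) (i : m) (j : l) :
    |(A * B) i j| ≤ rowNorm A i * rowNorm Bᵀ j := by
  refine abs_le_of_sq_le_sq ?_ (mul_nonneg (rowNorm_nonneg _ _) (rowNorm_nonneg _ _))
  rw [mul_pow, rowNorm_sq, rowNorm_sq, mul_apply]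
  exact Finset.sum_mul_sq_le_sq_mul_sq Finset.univ (A i) (Bᵀ j)

theorem rowNorm_mul_le_sum (A : Matrix m n ℝ) (B : Matrix n l ℝ) (i : m) :
    rowNorm (A * B) i ≤ ∑ j, |A i j| * rowNorm B j := by
  have e : WithLp.toLp 2 ((A * B) i) = ∑ j, A i j • WithLp.toLp 2 (B j) := by
    ext k
    simp [mul_apply]
  rw [rowNorm, e]
  refine (norm_sum_le _ _).trans (le_of_eq (Finset.sum_congr rfl fun j _ => ?_))
  rw [norm_smul]; rfl

/-- Each row of the product combines rows of `B`. With `A` the sparse error and `B` a projection,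
this is where sparsity (short ℓ¹ rows) meets incoherence. -/
theorem rowNorm_mul_le_of_forall_le (A : Matrix m n ℝ) {B : Matrix n l ℝ} {q : ℝ}
    (hB : ∀ j, rowNorm B j ≤ q) (i : m) : rowNorm (A * B) i ≤ (∑ j, |A i j|) * q := by
  refine (rowNorm_mul_le_sum A B i).trans ?_
  rw [Finset.sum_mul]
  exact Finset.sum_le_sum fun j _ => mul_le_mul_of_nonneg_left (hB j) (abs_nonneg _)

/-- The Schur test. -/
theorem opNorm_le_of_sum_abs_le {S : Matrix m n ℝ} {a b s : ℝ} (hs : 0 ≤ s) (ha : 0 < a)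
    (hb : 0 < b) (hrow : ∀ i, b * ∑ j, |S i j| ≤ s * a) (hcol : ∀ j, a * ∑ i, |S i j| ≤ s * b) :
    ‖S‖ ≤ s := by
  refine opNorm_le_of_forall_mulVec hs fun x => ?_
  refine le_of_sq_le_sq ?_ (mul_nonneg hs (norm_nonneg _))
  rw [mul_pow, EuclideanSpace.real_norm_sq_eq, EuclideanSpace.real_norm_sq_eq]
  have h1 : ∀ i, (S *ᵥ x.ofLp) i ^ 2 ≤ (s * a / b) * ∑ j, |S i j| * x.ofLp j ^ 2 := by
    intro i
    have h2 : (S *ᵥ x.ofLp) i ^ 2 ≤ (∑ j, |S i j|) * ∑ j, |S i j| * x.ofLp j ^ 2 := by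
      refine Finset.sum_sq_le_sum_mul_sum_of_sq_le_mul _ (fun j _ => abs_nonneg _)
        (fun j _ => by positivity) fun j _ => le_of_eq ?_
      rw [mul_pow, ← sq_abs (S i j)]; ring
    refine h2.trans (mul_le_mul_of_nonneg_right ?_
      (Finset.sum_nonneg fun j _ => by positivity))
    rw [le_div_iff₀ hb, mul_comm]
    exact hrow i
  calc ∑ i, (S *ᵥ x.ofLp) i ^ 2
      ≤ ∑ i, (s * a / b) * ∑ j, |S i j| * x.ofLp j ^ 2 := Finset.sum_le_sum fun i _ => h1 i
    _ = (s * a / b) * ∑ j, (∑ i, |S i j|) * x.ofLp j ^ 2 := by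
        rw [← Finset.mul_sum, Finset.sum_comm]
        simp only [Finset.sum_mul]
    _ ≤ (s * a / b) * ∑ j, (s * b / a) * x.ofLp j ^ 2 := by
        refine mul_le_mul_of_nonneg_left (Finset.sum_le_sum fun j _ => ?_) (by positivity)
        refine mul_le_mul_of_nonneg_right ?_ (sq_nonneg _)
        rw [le_div_iff₀ ha, mul_comm]
        exact hcol j
    _ = s ^ 2 * ∑ j, x.ofLp j ^ 2 := by
        rw [← Finset.mul_sum]; field_simp

/-- Compressing by two projections and subtracting is a contraction. -/
theorem frob_smul_sub_smul_le {P : Matrix m m ℝ} {Q : Matrix n n ℝ} (hP : Pᵀ = P)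
    (hP' : P * P = P) (hQ : Qᵀ = Q) (hQ' : Q * Q = Q) (A : Matrix m n ℝ) {η : ℝ} (h0 : 0 ≤ η)
    (h1 : η ≤ 2 / 3) : frob ((1 - η) • A - η • (P * A * Q)) ≤ (1 - η) * frob A := by
  refine le_of_sq_le_sq ?_ (mul_nonneg (by linarith) (frob_nonneg _))
  have hT : (P * A * Q)ᵀ = Q * Aᵀ * P := by
    rw [transpose_mul, transpose_mul, hP, hQ, ← Matrix.mul_assoc]
  -- `A ↦ P * A * Q` is an orthogonal projection for the trace inner product, so the cross term
  -- equals the square of the compressed part.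
  have e1 : (Aᵀ * (P * A * Q)).trace = frob (P * A * Q) ^ 2 := by
    rw [frob_sq_eq_trace, hT]
    calc (Aᵀ * (P * A * Q)).trace = (Aᵀ * P * A * (Q * Q)).trace := by
          rw [hQ']; simp only [Matrix.mul_assoc]
      _ = (Aᵀ * (P * P) * A * Q * Q).trace := by rw [hP']; simp only [Matrix.mul_assoc]
      _ = (Q * (Aᵀ * (P * P) * A * Q)).trace := by rw [trace_mul_comm]
      _ = _ := by simp only [Matrix.mul_assoc]
  have e2 : ((P * A * Q)ᵀ * A).trace = frob (P * A * Q) ^ 2 := by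
    rw [← e1, ← trace_transpose, transpose_mul, transpose_transpose]
  have e3 : frob ((1 - η) • A - η • (P * A * Q)) ^ 2 =
      (1 - η) ^ 2 * frob A ^ 2 - (2 * (1 - η) * η - η ^ 2) * frob (P * A * Q) ^ 2 := by
    rw [frob_sq_eq_trace, transpose_sub, transpose_smul, transpose_smul]
    simp only [Matrix.sub_mul, Matrix.mul_sub, Matrix.smul_mul, Matrix.mul_smul, trace_sub,
      trace_smul, e1, e2, ← frob_sq_eq_trace, smul_eq_mul]
    ring
  rw [e3, mul_pow]
  -- The subtracted coefficient is η(2 - 3η); its sign is the reason for the bound η ≤ 2/3.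
  nlinarith [mul_nonneg (mul_nonneg h0 (by linarith : 0 ≤ 2 - 3 * η)) (sq_nonneg (frob (P * A * Q)))]

theorem frob_eq_sqrt_card {U : Matrix m l ℝ} (h : Uᵀ * U = 1) : frob U = √(Fintype.card l) := by
  rw [eq_comm, Real.sqrt_eq_iff_mul_self_eq (by positivity) (frob_nonneg _), ← sq,
    frob_sq_eq_trace, h, trace_one]

theorem exists_inverse_of_mulVec_le {K : Matrix m m ℝ} {c : ℝ} (hc : 0 < c)
    (h : ∀ x : EuclideanSpace ℝ m, c * ‖x‖ ≤ ‖WithLp.toLp 2 (K *ᵥ x)‖) :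
    ∃ W : Matrix m m ℝ, K * W = 1 ∧ W * K = 1 ∧ ‖W‖ ≤ 1 / c := by
  have hinj : Function.Injective K.mulVec := by
    intro x y hxy
    have h1 := h (WithLp.toLp 2 (x - y))
    have h2 : K *ᵥ (x - y) = 0 := by rw [mulVec_sub, sub_eq_zero]; exact hxy
    simp only [h2, WithLp.toLp_zero, norm_zero] at h1
    have h3 : ‖WithLp.toLp 2 (x - y)‖ ≤ 0 := by
      by_contra hne
      push Not at hne
      exact absurd h1 (not_le.2 (mul_pos hc hne))
    have h4 := norm_le_zero_iff.1 h3
    rw [WithLp.toLp_eq_zero] at h4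
    exact sub_eq_zero.1 h4
  have hu : IsUnit K := mulVec_injective_iff_isUnit.1 hinj
  have hd := (isUnit_iff_isUnit_det K).1 hu
  refine ⟨K⁻¹, mul_nonsing_inv K hd, nonsing_inv_mul K hd, ?_⟩
  refine opNorm_le_of_forall_mulVec (by positivity) fun x => ?_
  have h1 := h (WithLp.toLp 2 (K⁻¹ *ᵥ x.ofLp))
  simp only [mulVec_mulVec, mul_nonsing_inv K hd, one_mulVec] at h1
  rw [div_mul_eq_mul_div, one_mul, le_div_iff₀ hc, mul_comm]
  exact h1

end MatrixNorms

/-! ### One iteration near a low-rank matrix, in terms of projections. -/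

section LowRankPairs

set_option linter.unusedSectionVars false

variable {m n r : Type*} [Fintype m] [Fintype n] [Fintype r] [DecidableEq m] [DecidableEq n]
  [DecidableEq r]

/-- Two nearby matrices `Xs` and `X` of the same rank, with orthonormal bases `U`, `V` of the column
and row spaces of `Xs`, the projections `P`, `Q` onto the column and row spaces of `X`, and
generalized inverses `Gs`, `G` of `Xs`, `X`. -/
structure LowRankPair (σ : ℝ) (Xs X : Matrix m n ℝ) (U : Matrix m r ℝ) (V : Matrix n r ℝ)
    (P : Matrix m m ℝ) (Q : Matrix n n ℝ) (Gs G : Matrix n m ℝ) : Prop where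
  pos : 0 < σ
  left_iso : Uᵀ * U = 1
  right_iso : Vᵀ * V = 1
  left_mul : U * Uᵀ * Xs = Xs
  mul_right : Xs * (V * Vᵀ) = Xs
  mul_ginv_mul : Xs * Gs * Xs = Xs
  ginv_norm : ‖Gs‖ ≤ 1 / σ
  left_symm : Pᵀ = P
  left_idem : P * P = P
  right_symm : Qᵀ = Q
  right_idem : Q * Q = Q
  left_proj : P * X = X
  right_proj : X * Q = X
  mul_pinv : X * G = P
  pinv_mul : G * X = Q
  pinv_left : G * P = G
  right_pinv : Q * G = G
  pinv_norm : ‖G‖ ≤ 1 / (0.97 * σ)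
  left_frob : frob P ≤ √(Fintype.card r)
  right_frob : frob Q ≤ √(Fintype.card r)
  near : ‖X - Xs‖ ≤ 0.03 * σ

namespace LowRankPair

variable {σ : ℝ} {Xs X : Matrix m n ℝ} {U : Matrix m r ℝ} {V : Matrix n r ℝ}
  {P : Matrix m m ℝ} {Q : Matrix n n ℝ} {Gs G : Matrix n m ℝ}

/-- The hypotheses are symmetric, so every estimate for rows also yields one for columns. -/
theorem transpose (h : LowRankPair σ Xs X U V P Q Gs G) :
    LowRankPair σ Xsᵀ Xᵀ V U Q P Gsᵀ Gᵀ where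
  pos := h.pos
  left_iso := h.right_iso
  right_iso := h.left_iso
  left_mul := by
    have := congrArg Matrix.transpose h.mul_right
    simpa [Matrix.mul_assoc] using this
  mul_right := by
    have := congrArg Matrix.transpose h.left_mul
    simpa [Matrix.mul_assoc] using this
  mul_ginv_mul := by
    have := congrArg Matrix.transpose h.mul_ginv_mul
    simpa [Matrix.mul_assoc] using this
  ginv_norm := (opNorm_transpose Gs).trans_le h.ginv_norm
  left_symm := h.right_symm
  left_idem := h.right_idem
  right_symm := h.left_symm
  right_idem := h.left_idem
  left_proj := by rw [← h.right_symm, ← transpose_mul, h.right_proj]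
  right_proj := by rw [← h.left_symm, ← transpose_mul, h.left_proj]
  mul_pinv := by rw [← transpose_mul, h.pinv_mul, h.right_symm]
  pinv_mul := by rw [← transpose_mul, h.mul_pinv, h.left_symm]
  pinv_left := by
    have := congrArg Matrix.transpose h.right_pinv
    rwa [transpose_mul, h.right_symm] at this
  right_pinv := by
    have := congrArg Matrix.transpose h.pinv_left
    rwa [transpose_mul, h.left_symm] at this
  pinv_norm := (opNorm_transpose G).trans_le h.pinv_norm
  left_frob := h.right_frob
  right_frob := h.left_frob
  near := by
    rw [← transpose_sub, opNorm_transpose]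
    exact h.near

theorem opNorm_left (h : LowRankPair σ Xs X U V P Q Gs G) : ‖P‖ ≤ 1 :=
  opNorm_le_one_of_projection h.left_symm h.left_idem

theorem opNorm_left_compl (h : LowRankPair σ Xs X U V P Q Gs G) : ‖1 - P‖ ≤ 1 :=
  opNorm_one_sub_le_one h.left_symm h.left_idem

theorem opNorm_left_basis (h : LowRankPair σ Xs X U V P Q Gs G) : ‖U‖ ≤ 1 :=
  opNorm_le_one_of_transpose_mul_self h.left_iso

theorem mul_compl_right (h : LowRankPair σ Xs X U V P Q Gs G) :
    Xs * (1 - Q) = -((X - Xs) * (1 - Q)) := by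
  rw [Matrix.sub_mul, Matrix.mul_sub X, h.right_proj]; simp

theorem compl_left_mul (h : LowRankPair σ Xs X U V P Q Gs G) :
    (1 - P) * Xs = -((1 - P) * (X - Xs)) := by
  rw [Matrix.mul_sub, Matrix.sub_mul 1 P X, h.left_proj]; simp

/-- The part of the error away from the tangent space at `X` is quadratic in the error. -/
theorem compl_mul_compl (h : LowRankPair σ Xs X U V P Q Gs G) :
    (1 - P) * (X - Xs) * (1 - Q) =
      -(((1 - P) * (X - Xs)) * (Gs * ((X - Xs) * (1 - Q)))) := by
  have h1 : (1 - P) * (X - Xs) * (1 - Q) = -((1 - P) * Xs * (1 - Q)) := by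
    rw [h.compl_left_mul]; simp
  rw [h1]
  -- Writing `Xs = Xs * Gs * Xs` exposes one factor killed up to the error by `1 - P` on the left
  -- and another by `1 - Q` on the right.
  conv_lhs => rw [← h.mul_ginv_mul]
  have h2 : (1 - P) * (Xs * Gs * Xs) * (1 - Q) = ((1 - P) * Xs) * (Gs * (Xs * (1 - Q))) := by
    simp only [Matrix.mul_assoc]
  rw [h2, h.compl_left_mul, h.mul_compl_right]
  simp

theorem frob_compl_mul_compl_le (h : LowRankPair σ Xs X U V P Q Gs G) {t : ℝ}
    (hF : frob (X - Xs) ≤ 0.03 * t * σ) :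
    frob ((1 - P) * (X - Xs) * (1 - Q)) ≤ 0.0009 * t * σ := by
  rw [h.compl_mul_compl, frob_neg]
  have h1 : frob ((1 - P) * (X - Xs)) ≤ 1 * (0.03 * t * σ) :=
    frob_mul_le_of_le' h.opNorm_left_compl hF
  have h2 : ‖Gs * ((X - Xs) * (1 - Q))‖ ≤ 1 / σ * (0.03 * σ * 1) :=
    opNorm_mul_le_of_le h.ginv_norm (opNorm_mul_le_of_le h.near h.transpose.opNorm_left_compl)
  refine (frob_mul_le_of_le h1 h2).trans (le_of_eq ?_)
  have := h.pos
  field_simp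
  norm_num
  ring

/-- The Frobenius norm of the error contracts. -/
theorem frob_step_le (h : LowRankPair σ Xs X U V P Q Gs G) {η s t : ℝ}
    (hη : η ∈ Set.Icc (1 / 4 : ℝ) (2 / 3)) (ht : t ≤ 1) (ht0 : 0 < t) {S : Matrix m n ℝ} (hS : ‖S‖ ≤ s)
    (hr : 1 ≤ Fintype.card r)
    (hs : √(Fintype.card r) * s ≤ 6e-4 * t * σ) (hF : frob (X - Xs) ≤ 0.03 * t * σ) :
    frob (X - η • ((X - Xs + S) * Q) - η • (P * (X - Xs + S))
      + η ^ 2 • ((X - Xs + S) * G * (X - Xs + S)) - Xs) ≤ 0.03 * ((1 - 0.6 * η) * t) * σ := by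
  obtain ⟨hη1, hη2⟩ := hη
  have hσ := h.pos
  have htσ : 0 < t * σ := mul_pos ht0 hσ
  have hs0 : 0 ≤ s := (norm_nonneg _).trans hS
  have hs' : s ≤ 6e-4 * t * σ := by
    refine le_trans ?_ hs
    have : (1 : ℝ) ≤ √(Fintype.card r) := Real.one_le_sqrt.2 (by exact_mod_cast hr)
    nlinarith
  set Δ := X - Xs with hΔ
  -- A contracting part, a part quadratic in Δ, two noise terms and the second-order term. In the
  -- latter, `G = Q * G` supplies the factor `Q`: `S` is controlled only in operator norm, and `Q`
  -- converts this to a Frobenius bound.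
  have e : X - η • ((Δ + S) * Q) - η • (P * (Δ + S)) + η ^ 2 • ((Δ + S) * G * (Δ + S)) - Xs =
      ((1 - η) • Δ - η • (P * Δ * Q)) + η • ((1 - P) * Δ * (1 - Q)) - η • (S * Q) - η • (P * S)
        + η ^ 2 • (((Δ + S) * Q) * (G * (Δ + S))) := by
    have e1 : ((Δ + S) * Q) * (G * (Δ + S)) = (Δ + S) * G * (Δ + S) := by
      rw [Matrix.mul_assoc, ← Matrix.mul_assoc Q, h.right_pinv, Matrix.mul_assoc]
    rw [e1]
    have e2 : X = Δ + Xs := by rw [hΔ]; abel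
    have e3 : (1 - P) * Δ * (1 - Q) = Δ - P * Δ - Δ * Q + P * Δ * Q := by
      simp only [Matrix.sub_mul, Matrix.mul_sub, Matrix.one_mul, Matrix.mul_one]; abel
    have e4 : (Δ + S) * Q = Δ * Q + S * Q := Matrix.add_mul ..
    have e5 : P * (Δ + S) = P * Δ + P * S := Matrix.mul_add ..
    rw [e3, e4, e5]
    generalize (Δ + S) * G * (Δ + S) = Y
    conv_lhs => rw [e2]
    module
  rw [e]
  have b1 := frob_smul_sub_smul_le h.left_symm h.left_idem h.right_symm h.right_idem Δ
    (by linarith : 0 ≤ η) hη2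
  have b2 := h.frob_compl_mul_compl_le hF
  have b3 : frob (S * Q) ≤ 6e-4 * t * σ := by
    refine (frob_mul_le_of_le' hS h.right_frob).trans ?_
    rwa [mul_comm]
  have b4 : frob (P * S) ≤ 6e-4 * t * σ := (frob_mul_le_of_le h.left_frob hS).trans hs
  have b5 : frob ((Δ + S) * Q) ≤ 0.0306 * t * σ := by
    rw [Matrix.add_mul]
    refine (frob_add_le _ _).trans ?_
    have := frob_mul_le_of_le hF h.transpose.opNorm_left
    linarith
  have b6 : ‖G * (Δ + S)‖ ≤ 1 / (0.97 * σ) * (0.0306 * σ) := by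
    refine opNorm_mul_le_of_le h.pinv_norm ((norm_add_le _ _).trans ?_)
    have := h.near
    nlinarith
  have b7 : frob (((Δ + S) * Q) * (G * (Δ + S))) ≤ 0.001 * t * σ := by
    refine (frob_mul_le_of_le b5 b6).trans ?_
    have : 1 / (0.97 * σ) * (0.0306 * σ) ≤ 0.032 := by
      rw [div_mul_eq_mul_div, one_mul, div_le_iff₀ (by positivity)]
      nlinarith
    nlinarith
  have c1 := frob_add_le (((1 - η) • Δ - η • (P * Δ * Q)) + η • ((1 - P) * Δ * (1 - Q))
    - η • (S * Q) - η • (P * S)) (η ^ 2 • (((Δ + S) * Q) * (G * (Δ + S))))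
  have c2 := frob_sub_le (((1 - η) • Δ - η • (P * Δ * Q)) + η • ((1 - P) * Δ * (1 - Q))
    - η • (S * Q)) (η • (P * S))
  have c3 := frob_sub_le (((1 - η) • Δ - η • (P * Δ * Q)) + η • ((1 - P) * Δ * (1 - Q)))
    (η • (S * Q))
  have c4 := frob_add_le ((1 - η) • Δ - η • (P * Δ * Q)) (η • ((1 - P) * Δ * (1 - Q)))
  rw [frob_smul, abs_of_nonneg (by positivity)] at c1
  rw [frob_smul, abs_of_nonneg (by linarith)] at c2 c3 c4
  have d1 := mul_le_mul_of_nonneg_left hF (by linarith : 0 ≤ 1 - η)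
  have d2 := mul_le_mul_of_nonneg_left b2 (by linarith : 0 ≤ η)
  have d3 := mul_le_mul_of_nonneg_left b3 (by linarith : 0 ≤ η)
  have d4 := mul_le_mul_of_nonneg_left b4 (by linarith : 0 ≤ η)
  have d5 := mul_le_mul_of_nonneg_left b7 (by positivity : 0 ≤ η ^ 2)
  have d6 : η ^ 2 * (t * σ) ≤ η * (t * σ) :=
    mul_le_mul_of_nonneg_right (by nlinarith) htσ.le
  have d7 : 0 < η * (t * σ) := mul_pos (by linarith) htσ
  -- In units of tσ: 0.03(1-η) + η(0.0009 + 2·0.0006) + 0.001η² ≤ 0.03(1-0.6η), because 0.0031 ≤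
  -- 0.4·0.03.
  nlinarith

/-- Incoherence of the column space of `X`. -/
theorem rowNorm_left_le (h : LowRankPair σ Xs X U V P Q Gs G) {u : ℝ} {i : m} (hu : rowNorm U i ≤ u)
    {t : ℝ} (ht : t ≤ 1) (hX : rowNorm (X - Xs) i ≤ 0.5 * u * t * σ) : rowNorm P i ≤ 1.6 * u := by
  have hσ := h.pos
  have hu0 : 0 ≤ u := (rowNorm_nonneg _ _).trans hu
  have e1 : Xs * G = P - (X - Xs) * G := by rw [Matrix.sub_mul, h.mul_pinv]; simp
  -- `P = X * G = Xs * G + (X - Xs) * G`, and `Xs * G` lies in the column space of `U`. The two row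
  -- bounds are 1.031u and 0.52u.
  have e2 : P = U * (Uᵀ * (P - (X - Xs) * G)) + (X - Xs) * G := by
    rw [← e1, ← Matrix.mul_assoc, ← Matrix.mul_assoc, h.left_mul, e1]; simp
  have k : 0.03 * σ * (1 / (0.97 * σ)) ≤ 0.031 := by
    rw [mul_one_div, div_le_iff₀ (by positivity)]; nlinarith
  have b1 : ‖(X - Xs) * G‖ ≤ 0.031 := (opNorm_mul_le_of_le h.near h.pinv_norm).trans k
  have b2 : ‖Uᵀ * (P - (X - Xs) * G)‖ ≤ 1 * 1.031 := by
    refine opNorm_mul_le_of_le ((opNorm_transpose U).trans_le h.opNorm_left_basis) ?_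
    have := norm_sub_le P ((X - Xs) * G)
    have := h.opNorm_left
    linarith
  have b3 := rowNorm_mul_le_of_le hu b2
  have b4 := rowNorm_mul_le_of_le hX h.pinv_norm
  have b5 : 0.5 * u * t * σ * (1 / (0.97 * σ)) ≤ 0.52 * u := by
    rw [mul_one_div, div_le_iff₀ (by positivity)]
    nlinarith [mul_le_mul_of_nonneg_right ht (mul_nonneg hu0 hσ.le), mul_nonneg hu0 hσ.le]
  have b6 := rowNorm_add_le (U * (Uᵀ * (P - (X - Xs) * G))) ((X - Xs) * G) i
  rw [← e2] at b6
  linarith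

/-- As `X * (1 - Q) = 0`, only `-Xs * (1 - Q)` is left, in the column space of `U`. Its rows are
thus bounded by u‖X - Xs‖, much better than the propagated row bound. -/
theorem mul_compl_right_eq (h : LowRankPair σ Xs X U V P Q Gs G) :
    (X - Xs) * (1 - Q) = U * (Uᵀ * ((X - Xs) * (1 - Q))) := by
  have h1 : (X - Xs) * (1 - Q) = -(Xs * (1 - Q)) := by rw [h.mul_compl_right, neg_neg]
  rw [h1, Matrix.mul_neg, Matrix.mul_neg, ← Matrix.mul_assoc Uᵀ, ← Matrix.mul_assoc U,
    ← Matrix.mul_assoc U, h.left_mul]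

theorem rowNorm_mul_compl_right_le (h : LowRankPair σ Xs X U V P Q Gs G) {u d : ℝ} {i : m}
    (hu : rowNorm U i ≤ u) (hd : ‖X - Xs‖ ≤ d) :
    rowNorm ((X - Xs) * (1 - Q)) i ≤ u * d := by
  rw [h.mul_compl_right_eq]
  have b : ‖Uᵀ * ((X - Xs) * (1 - Q))‖ ≤ 1 * (d * 1) :=
    opNorm_mul_le_of_le ((opNorm_transpose U).trans_le h.opNorm_left_basis)
      (opNorm_mul_le_of_le hd h.transpose.opNorm_left_compl)
  simpa using rowNorm_mul_le_of_le hu b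

/-- The norms of the rows of the error contract. -/
theorem rowNorm_step_le (h : LowRankPair σ Xs X U V P Q Gs G) {η s t u v : ℝ}
    (hη : η ∈ Set.Icc (1 / 4 : ℝ) (2 / 3)) (ht : t ≤ 1) (ht0 : 0 < t) {S : Matrix m n ℝ}
    (hS : ‖S‖ ≤ s) (hs : s ≤ 6e-4 * t * σ) (hF : ‖X - Xs‖ ≤ 0.03 * t * σ) {i : m}
    (hu : rowNorm U i ≤ u) (hX : rowNorm (X - Xs) i ≤ 0.5 * u * t * σ)
    (hQ : ∀ j, rowNorm Q j ≤ 1.6 * v) (hrow : v * ∑ j, |S i j| ≤ s * u) :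
    rowNorm (X - η • ((X - Xs + S) * Q) - η • (P * (X - Xs + S))
      + η ^ 2 • ((X - Xs + S) * G * (X - Xs + S)) - Xs) i ≤
        0.5 * u * ((1 - 0.6 * η) * t) * σ := by
  obtain ⟨hη1, hη2⟩ := hη
  have hσ := h.pos
  have hu0 : 0 ≤ u := (rowNorm_nonneg _ _).trans hu
  have htσ : 0 ≤ u * (t * σ) := by positivity
  have hP := h.rowNorm_left_le hu ht hX
  have a1 := h.rowNorm_mul_compl_right_le hu hF
  have hnear := h.near
  set Δ := X - Xs with hΔ
  -- Unlike in the Frobenius estimate, `P * Δ` needs no cancellation: the rows of `P` are incoherent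
  -- and ‖Δ‖ is small.
  have e : X - η • ((Δ + S) * Q) - η • (P * (Δ + S)) + η ^ 2 • ((Δ + S) * G * (Δ + S)) - Xs =
      (1 - η) • Δ + η • (Δ * (1 - Q)) - η • (S * Q) - η • (P * (Δ + S))
        + η ^ 2 • ((Δ * Q + S * Q) * (G * (Δ + S))) := by
    have e1 : (Δ * Q + S * Q) * (G * (Δ + S)) = (Δ + S) * G * (Δ + S) := by
      rw [← Matrix.add_mul, Matrix.mul_assoc, ← Matrix.mul_assoc Q, h.right_pinv, Matrix.mul_assoc]
    rw [e1]
    have e2 : X = Δ + Xs := by rw [hΔ]; abel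
    have e3 : Δ * (1 - Q) = Δ - Δ * Q := by rw [Matrix.mul_sub, Matrix.mul_one]
    have e4 : (Δ + S) * Q = Δ * Q + S * Q := Matrix.add_mul ..
    rw [e3, e4]
    generalize (Δ + S) * G * (Δ + S) = Y
    generalize P * (Δ + S) = Z
    conv_lhs => rw [e2]
    module
  rw [e]
  have b1 : rowNorm (S * Q) i ≤ 1.6 * (u * s) := by
    have := rowNorm_mul_le_of_forall_le S hQ i
    nlinarith
  have us : u * s ≤ 6e-4 * (u * (t * σ)) := by nlinarith
  have bE : ‖Δ + S‖ ≤ 0.0306 * (t * σ) := (norm_add_le _ _).trans (by linarith)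
  have b2 : rowNorm (P * (Δ + S)) i ≤ 1.6 * u * (0.0306 * (t * σ)) := rowNorm_mul_le_of_le hP bE
  have b3 : ‖G * (Δ + S)‖ ≤ 0.032 := by
    refine (opNorm_mul_le_of_le h.pinv_norm (bE.trans (?_ : _ ≤ 0.0306 * σ))).trans ?_
    · nlinarith
    · rw [div_mul_eq_mul_div, one_mul, div_le_iff₀ (by positivity)]
      nlinarith
  have b4 : rowNorm (Δ * Q + S * Q) i ≤ 0.6 * (u * (t * σ)) := by
    refine (rowNorm_add_le _ _ _).trans ?_
    have := rowNorm_mul_le_of_le hX h.transpose.opNorm_left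
    linarith
  have b5 := rowNorm_mul_le_of_le b4 b3
  have c1 := rowNorm_add_le ((1 - η) • Δ + η • (Δ * (1 - Q)) - η • (S * Q) - η • (P * (Δ + S)))
    (η ^ 2 • ((Δ * Q + S * Q) * (G * (Δ + S)))) i
  have c2 := rowNorm_sub_le ((1 - η) • Δ + η • (Δ * (1 - Q)) - η • (S * Q)) (η • (P * (Δ + S))) i
  have c3 := rowNorm_sub_le ((1 - η) • Δ + η • (Δ * (1 - Q))) (η • (S * Q)) i
  have c4 := rowNorm_add_le ((1 - η) • Δ) (η • (Δ * (1 - Q))) i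
  rw [rowNorm_smul, abs_of_nonneg (by positivity)] at c1
  rw [rowNorm_smul, abs_of_nonneg (by linarith)] at c2 c3
  rw [rowNorm_smul, rowNorm_smul, abs_of_nonneg (by linarith), abs_of_nonneg (by linarith)] at c4
  have d1 := mul_le_mul_of_nonneg_left hX (by linarith : 0 ≤ 1 - η)
  have d2 := mul_le_mul_of_nonneg_left a1 (by linarith : 0 ≤ η)
  have d3 := mul_le_mul_of_nonneg_left b1 (by linarith : 0 ≤ η)
  have d3' := mul_le_mul_of_nonneg_left us (by linarith : 0 ≤ η)
  have d4 := mul_le_mul_of_nonneg_left b2 (by linarith : 0 ≤ η)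
  have d5 := mul_le_mul_of_nonneg_left b5 (by positivity : 0 ≤ η ^ 2)
  have d6 : η ^ 2 * (u * (t * σ)) ≤ η * (u * (t * σ)) :=
    mul_le_mul_of_nonneg_right (by nlinarith) htσ
  have d7 : 0 ≤ η * (u * (t * σ)) := mul_nonneg (by linarith) htσ
  -- In units of utσ the terms besides 0.5(1-η) are below η(0.03 + 0.001 + 0.049 + 0.0192) < 0.1η,
  -- while 0.2η is available.
  linarith

/-- Entrywise bound of the error. -/
theorem abs_apply_le (h : LowRankPair σ Xs X U V P Q Gs G) {t u v : ℝ} (ht : t ≤ 1) (ht0 : 0 ≤ t)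
    (hF : ‖X - Xs‖ ≤ 0.03 * t * σ) {i : m} {j : n} (hu : rowNorm U i ≤ u) (hv : rowNorm V j ≤ v)
    (hX : rowNorm (X - Xs) i ≤ 0.5 * u * t * σ) (hX' : rowNorm (X - Xs)ᵀ j ≤ 0.5 * v * t * σ) :
    |(X - Xs) i j| ≤ 3 * (u * v) * t * σ := by
  have hσ := h.pos
  have hu0 : 0 ≤ u := (rowNorm_nonneg _ _).trans hu
  have hv0 : 0 ≤ v := (rowNorm_nonneg _ _).trans hv
  have hU := h.opNorm_left_basis
  have hV := h.transpose.opNorm_left_basis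
  have e5 : (1 - U * Uᵀ) * X = (1 - U * Uᵀ) * (X - Xs) := by
    rw [Matrix.mul_sub, Matrix.sub_mul 1 _ Xs, h.left_mul]; simp
  have e6 : X * (1 - V * Vᵀ) = (X - Xs) * (1 - V * Vᵀ) := by
    rw [Matrix.sub_mul, Matrix.mul_sub Xs, h.mul_right]; simp
  -- The complementary projections kill `Xs`, so Δ may be replaced by `X = X * G * X`; the component
  -- off both spaces becomes a product of two error factors.
  have e7 : (1 - U * Uᵀ) * (X - Xs) * (1 - V * Vᵀ) =
      ((1 - U * Uᵀ) * (X - Xs) * G) * ((X - Xs) * (1 - V * Vᵀ)) := by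
    rw [← e6, ← e5]
    have : X * G * X = X := by rw [h.mul_pinv, h.left_proj]
    calc (1 - U * Uᵀ) * X * (1 - V * Vᵀ) = (1 - U * Uᵀ) * (X * G * X) * (1 - V * Vᵀ) := by rw [this]
      _ = _ := by simp only [Matrix.mul_assoc]
  set Δ := X - Xs with hΔ
  -- Each summand is a product whose left rows are of order u and whose right columns are of order
  -- v, so Cauchy–Schwarz yields the factor uv.
  have e : Δ = U * (Uᵀ * Δ) + (Δ * V) * Vᵀ - (U * (Uᵀ * Δ * V)) * Vᵀ
      + ((1 - U * Uᵀ) * Δ * G) * (Δ * (1 - V * Vᵀ)) := by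
    rw [← e7]
    simp only [Matrix.sub_mul, Matrix.mul_sub, Matrix.one_mul, Matrix.mul_one, Matrix.mul_assoc]
    abel
  have b1 : |(U * (Uᵀ * Δ)) i j| ≤ u * (0.5 * v * t * σ) := by
    refine (abs_mul_apply_le _ _ _ _).trans
      (mul_le_mul hu ?_ (rowNorm_nonneg _ _) hu0)
    rw [transpose_mul, transpose_transpose]
    simpa using rowNorm_mul_le_of_le hX' hU
  have b2 : |((Δ * V) * Vᵀ) i j| ≤ 0.5 * u * t * σ * v := by
    refine (abs_mul_apply_le _ _ _ _).trans
      (mul_le_mul ?_ hv (rowNorm_nonneg _ _) (by positivity))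
    simpa using rowNorm_mul_le_of_le hX hV
  have b3 : |((U * (Uᵀ * Δ * V)) * Vᵀ) i j| ≤ u * (0.03 * t * σ) * v := by
    refine (abs_mul_apply_le _ _ _ _).trans
      (mul_le_mul ?_ hv (rowNorm_nonneg _ _) (by positivity))
    refine rowNorm_mul_le_of_le hu ?_
    have := opNorm_mul_le_of_le (opNorm_mul_le_of_le ((opNorm_transpose U).trans_le hU) hF) hV
    simpa using this
  have c1 : rowNorm ((1 - U * Uᵀ) * Δ) i ≤ 0.53 * (u * t * σ) := by
    rw [Matrix.sub_mul, Matrix.one_mul, Matrix.mul_assoc]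
    have := rowNorm_mul_le_of_le hu
      (opNorm_mul_le_of_le ((opNorm_transpose U).trans_le hU) hF)
    have := rowNorm_sub_le Δ (U * (Uᵀ * Δ)) i
    linarith
  have c2 : rowNorm (Δ * (1 - V * Vᵀ))ᵀ j ≤ 0.53 * (v * t * σ) := by
    have : (Δ * (1 - V * Vᵀ))ᵀ = Δᵀ - V * (Vᵀ * Δᵀ) := by
      rw [Matrix.mul_sub, Matrix.mul_one, transpose_sub, transpose_mul, transpose_mul,
        transpose_transpose, Matrix.mul_assoc]
    rw [this]
    have := rowNorm_mul_le_of_le hv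
      (opNorm_mul_le_of_le ((opNorm_transpose V).trans_le hV) ((opNorm_transpose Δ).trans_le hF))
    have := rowNorm_sub_le Δᵀ (V * (Vᵀ * Δᵀ)) j
    linarith
  have c3 : rowNorm ((1 - U * Uᵀ) * Δ * G) i ≤ 0.6 * (u * t) := by
    refine (rowNorm_mul_le_of_le c1 h.pinv_norm).trans ?_
    rw [mul_one_div, div_le_iff₀ (by positivity)]
    have : 0 ≤ u * t * σ := by positivity
    linarith
  have b4 : |((1 - U * Uᵀ) * Δ * G * (Δ * (1 - V * Vᵀ)) : Matrix m n ℝ) i j| ≤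
      0.6 * (u * t) * (0.53 * (v * t * σ)) :=
    (abs_mul_apply_le _ _ _ _).trans (mul_le_mul c3 c2 (rowNorm_nonneg _ _) (by positivity))
  have eij := congrFun (congrFun e i) j
  simp only [Matrix.add_apply, Matrix.sub_apply] at eij
  rw [eij]
  have hw : 0 ≤ u * v * t * σ := by positivity
  have hw2 : (u * v * t * σ) * t ≤ u * v * t * σ := mul_le_of_le_one_right hw ht
  rw [abs_le] at b1 b2 b3 b4 ⊢
  constructor <;> nlinarith
end LowRankPair

end LowRankPairs

/-! ### Factorizations, propagation of the error bounds and initialization. -/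

section Dynamics

set_option linter.unusedSectionVars false

variable {m n r : Type*} [Fintype m] [Fintype n] [Fintype r] [DecidableEq m] [DecidableEq n]
  [DecidableEq r]

theorem isUnit_gram_of_left_inverse {L : Matrix m r ℝ} {N : Matrix r m ℝ} (h : N * L = 1) :
    IsUnit (Lᵀ * L) := by
  refine mulVec_injective_iff_isUnit.1 fun x y hxy => ?_
  have h0 : (Lᵀ * L) *ᵥ (x - y) = 0 := by rw [mulVec_sub, sub_eq_zero]; exact hxy
  have h1 : (L *ᵥ (x - y)) ⬝ᵥ (L *ᵥ (x - y)) = 0 := by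
    rw [dotProduct_mulVec, ← mulVec_transpose, mulVec_mulVec, h0, zero_dotProduct]
  have h2 := dotProduct_self_eq_zero.1 h1
  have h3 : N *ᵥ (L *ᵥ (x - y)) = 0 := by rw [h2, mulVec_zero]
  rw [mulVec_mulVec, h, one_mulVec] at h3
  exact sub_eq_zero.1 h3

/-- The orthogonal projection onto the column space of a matrix of full column rank. -/
noncomputable def colProj (L : Matrix m r ℝ) : Matrix m m ℝ := L * (Lᵀ * L)⁻¹ * Lᵀ

theorem transpose_gram_inv (L : Matrix m r ℝ) : ((Lᵀ * L)⁻¹)ᵀ = (Lᵀ * L)⁻¹ := by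
  rw [transpose_nonsing_inv, transpose_mul, transpose_transpose]

theorem transpose_colProj (L : Matrix m r ℝ) : (colProj L)ᵀ = colProj L := by
  rw [colProj, transpose_mul, transpose_mul, transpose_gram_inv, transpose_transpose,
    Matrix.mul_assoc]

theorem colProj_mul {L : Matrix m r ℝ} (h : IsUnit (Lᵀ * L)) : colProj L * L = L := by
  rw [colProj, Matrix.mul_assoc, Matrix.mul_assoc,
    nonsing_inv_mul _ ((isUnit_iff_isUnit_det _).1 h), Matrix.mul_one]

theorem colProj_mul_colProj {L : Matrix m r ℝ} (h : IsUnit (Lᵀ * L)) :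
    colProj L * colProj L = colProj L := by
  have e : colProj L * colProj L = colProj L * L * (Lᵀ * L)⁻¹ * Lᵀ := by
    conv_lhs => rhs; rw [colProj]
    simp only [Matrix.mul_assoc]
  rw [e, colProj_mul h, colProj]

theorem frob_colProj {L : Matrix m r ℝ} (h : IsUnit (Lᵀ * L)) :
    frob (colProj L) = √(Fintype.card r) := by
  rw [eq_comm, Real.sqrt_eq_iff_mul_self_eq (by positivity) (frob_nonneg _), ← sq,
    frob_sq_eq_trace, transpose_colProj, colProj_mul_colProj h, colProj, trace_mul_comm,
    ← Matrix.mul_assoc, mul_nonsing_inv _ ((isUnit_iff_isUnit_det _).1 h), trace_one]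

/-- The Gram matrix being a unit forces `T` to be invertible, so `T` does not change the column
space. -/
theorem colProj_mul_of_isometry {A : Matrix m r ℝ} {T : Matrix r r ℝ} (hA : Aᵀ * A = 1)
    (h : IsUnit ((A * T)ᵀ * (A * T))) : colProj (A * T) = A * Aᵀ := by
  have e : (A * T)ᵀ * (A * T) = Tᵀ * T := by
    rw [transpose_mul, Matrix.mul_assoc, ← Matrix.mul_assoc Aᵀ, hA, Matrix.one_mul]
  have hT : IsUnit T.det := by
    rw [e, isUnit_iff_isUnit_det, det_mul] at h
    exact isUnit_of_mul_isUnit_right h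
  have hT' : IsUnit Tᵀ.det := by rwa [det_transpose]
  rw [colProj, e, Matrix.mul_inv_rev, transpose_mul]
  calc A * T * (T⁻¹ * Tᵀ⁻¹) * (Tᵀ * Aᵀ) = A * (T * T⁻¹) * (Tᵀ⁻¹ * Tᵀ) * Aᵀ := by
        simp only [Matrix.mul_assoc]
    _ = A * Aᵀ := by
        rw [mul_nonsing_inv _ hT, nonsing_inv_mul _ hT', Matrix.mul_one, Matrix.mul_one]

/-- A factorized matrix close to `U * D * Vᵀ` has factors of full rank and forms a
`LowRankPair` with it. -/
theorem LowRankPair.of_factors {σ : ℝ} (hσ : 0 < σ) {U : Matrix m r ℝ} {V : Matrix n r ℝ}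
    {D W : Matrix r r ℝ} (hU : Uᵀ * U = 1) (hV : Vᵀ * V = 1) (hDW : D * W = 1) (hW : ‖W‖ ≤ 1 / σ)
    {L : Matrix m r ℝ} {M : Matrix n r ℝ} (hnear : ‖L * Mᵀ - U * D * Vᵀ‖ ≤ 0.03 * σ) :
    IsUnit (Lᵀ * L) ∧ IsUnit (Mᵀ * M) ∧
      LowRankPair σ (U * D * Vᵀ) (L * Mᵀ) U V (colProj L) (colProj M) (V * W * Uᵀ)
        (M * (Mᵀ * M)⁻¹ * ((Lᵀ * L)⁻¹ * Lᵀ)) := by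
  have hWD : W * D = 1 := mul_eq_one_comm.1 hDW
  have hU1 := opNorm_le_one_of_transpose_mul_self hU
  have hV1 := opNorm_le_one_of_transpose_mul_self hV
  -- The core `Uᵀ * X * V` is `D`, which expands by at least σ, plus a perturbation of norm at most
  -- 0.03σ; hence 0.97σ.
  obtain ⟨K', hK1, hK2, hK3⟩ : ∃ K' : Matrix r r ℝ, (Uᵀ * (L * Mᵀ) * V) * K' = 1 ∧
      K' * (Uᵀ * (L * Mᵀ) * V) = 1 ∧ ‖K'‖ ≤ 1 / (0.97 * σ) := by
    refine exists_inverse_of_mulVec_le (by positivity) fun x => ?_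
    have e : Uᵀ * (L * Mᵀ) * V = D + Uᵀ * (L * Mᵀ - U * D * Vᵀ) * V := by
      rw [Matrix.mul_sub, Matrix.sub_mul, Matrix.mul_assoc U, ← Matrix.mul_assoc Uᵀ U, hU,
        Matrix.one_mul, Matrix.mul_assoc D, hV, Matrix.mul_one]
      abel
    have hE : ‖Uᵀ * (L * Mᵀ - U * D * Vᵀ) * V‖ ≤ 1 * (0.03 * σ) * 1 :=
      opNorm_mul_le_of_le (opNorm_mul_le_of_le ((opNorm_transpose U).trans_le hU1) hnear) hV1
    generalize Uᵀ * (L * Mᵀ - U * D * Vᵀ) * V = E at e hE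
    rw [e, add_mulVec, WithLp.toLp_add]
    have h1 : σ * ‖x‖ ≤ ‖WithLp.toLp 2 (D *ᵥ x.ofLp)‖ := by
      have h2 := l2_opNorm_mulVec W (WithLp.toLp 2 (D *ᵥ x.ofLp))
      simp only [mulVec_mulVec, hWD, one_mulVec] at h2
      have h3 : ‖x‖ ≤ 1 / σ * ‖WithLp.toLp 2 (D *ᵥ x.ofLp)‖ :=
        h2.trans (mul_le_mul_of_nonneg_right hW (norm_nonneg _))
      rw [div_mul_eq_mul_div, one_mul, le_div_iff₀ hσ] at h3
      linarith
    have h4 : ‖WithLp.toLp 2 (E *ᵥ x.ofLp)‖ ≤ (0.03 * σ) * ‖x‖ := by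
      refine (l2_opNorm_mulVec E x).trans (mul_le_mul_of_nonneg_right ?_ (norm_nonneg _))
      linarith
    have h5 := norm_sub_le_norm_add (WithLp.toLp 2 (D *ᵥ x.ofLp)) (WithLp.toLp 2 (E *ᵥ x.ofLp))
    linarith
  have e1 : Uᵀ * (L * Mᵀ) * V = (Uᵀ * L) * (Mᵀ * V) := by simp only [Matrix.mul_assoc]
  rw [e1] at hK1 hK2
  -- The square core factors as `(Uᵀ * L) * (Mᵀ * V)`, so its invertibility gives one-sided inverses
  -- of `L` and `M`, hence full column rank.
  have hL' : (Mᵀ * V * K' * Uᵀ) * L = 1 := by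
    have : (Uᵀ * L) * (Mᵀ * V * K') = 1 := by rw [← hK1]; simp only [Matrix.mul_assoc]
    rw [← mul_eq_one_comm.1 this]; simp only [Matrix.mul_assoc]
  have hMt : Mᵀ * (V * K' * (Uᵀ * L)) = 1 := by
    have : (K' * (Uᵀ * L)) * (Mᵀ * V) = 1 := by rw [← hK2]; simp only [Matrix.mul_assoc]
    rw [← mul_eq_one_comm.1 this]; simp only [Matrix.mul_assoc]
  have hM' : (V * K' * (Uᵀ * L))ᵀ * M = 1 := by
    have := congrArg Matrix.transpose hMt
    rwa [transpose_mul, transpose_transpose, transpose_one] at this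
  have uL := isUnit_gram_of_left_inverse hL'
  have uM := isUnit_gram_of_left_inverse hM'
  have dL := (isUnit_iff_isUnit_det _).1 uL
  have dM := (isUnit_iff_isUnit_det _).1 uM
  have hUU : Uᵀ * (U * D * Vᵀ) = D * Vᵀ := by
    rw [Matrix.mul_assoc, ← Matrix.mul_assoc Uᵀ, hU, Matrix.one_mul]
  have hVV : U * D * Vᵀ * V = U * D := by rw [Matrix.mul_assoc, hV, Matrix.mul_one]
  have tM : Mᵀ * colProj M = Mᵀ := by
    rw [← transpose_colProj, ← transpose_mul, colProj_mul uM]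
  have tL : Lᵀ * colProj L = Lᵀ := by
    rw [← transpose_colProj, ← transpose_mul, colProj_mul uL]
  refine ⟨uL, uM, ?_⟩
  refine
    { pos := hσ
      left_iso := hU
      right_iso := hV
      left_mul := by rw [Matrix.mul_assoc, hUU, Matrix.mul_assoc]
      mul_right := by rw [← Matrix.mul_assoc, hVV]
      mul_ginv_mul := ?_
      ginv_norm := ?_
      left_symm := transpose_colProj L
      left_idem := colProj_mul_colProj uL
      right_symm := transpose_colProj M
      right_idem := colProj_mul_colProj uM
      left_proj := by rw [← Matrix.mul_assoc, colProj_mul uL]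
      right_proj := by rw [Matrix.mul_assoc, tM]
      mul_pinv := ?_
      pinv_mul := ?_
      pinv_left := by rw [Matrix.mul_assoc, Matrix.mul_assoc _ Lᵀ, tL]
      right_pinv := by rw [← Matrix.mul_assoc, ← Matrix.mul_assoc _ M, colProj_mul uM]
      pinv_norm := ?_
      left_frob := (frob_colProj uL).le
      right_frob := (frob_colProj uM).le
      near := hnear }
  · calc U * D * Vᵀ * (V * W * Uᵀ) * (U * D * Vᵀ)
        = U * D * (Vᵀ * V) * W * (Uᵀ * U) * D * Vᵀ := by simp only [Matrix.mul_assoc]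
      _ = U * (D * W) * D * Vᵀ := by
        rw [hU, hV]; simp only [Matrix.mul_assoc, Matrix.one_mul]
      _ = U * D * Vᵀ := by rw [hDW, Matrix.mul_one]
  · have := opNorm_mul_le_of_le (opNorm_mul_le_of_le hV1 hW) ((opNorm_transpose U).trans_le hU1)
    simpa using this
  · calc L * Mᵀ * (M * (Mᵀ * M)⁻¹ * ((Lᵀ * L)⁻¹ * Lᵀ))
        = L * ((Mᵀ * M) * (Mᵀ * M)⁻¹) * (Lᵀ * L)⁻¹ * Lᵀ := by simp only [Matrix.mul_assoc]
      _ = colProj L := by rw [mul_nonsing_inv _ dM, Matrix.mul_one, colProj]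
  · calc M * (Mᵀ * M)⁻¹ * ((Lᵀ * L)⁻¹ * Lᵀ) * (L * Mᵀ)
        = M * (Mᵀ * M)⁻¹ * ((Lᵀ * L)⁻¹ * (Lᵀ * L)) * Mᵀ := by simp only [Matrix.mul_assoc]
      _ = colProj M := by rw [nonsing_inv_mul _ dL, Matrix.mul_one, colProj]
  -- The pseudoinverse is a compression of `V * K' * Uᵀ`, so the conditioning of `L` and `M`
  -- themselves plays no role.
  · have e : M * (Mᵀ * M)⁻¹ * ((Lᵀ * L)⁻¹ * Lᵀ) = colProj M * (V * K' * Uᵀ) * colProj L := by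
      calc M * (Mᵀ * M)⁻¹ * ((Lᵀ * L)⁻¹ * Lᵀ)
          = M * (Mᵀ * M)⁻¹ * (Mᵀ * (V * K' * (Uᵀ * L))) * ((Lᵀ * L)⁻¹ * Lᵀ) := by
            rw [hMt, Matrix.mul_one]
        _ = _ := by simp only [colProj, Matrix.mul_assoc]
    rw [e]
    have p1 := opNorm_le_one_of_projection (transpose_colProj L) (colProj_mul_colProj uL)
    have p2 := opNorm_le_one_of_projection (transpose_colProj M) (colProj_mul_colProj uM)
    have := opNorm_mul_le_of_le (opNorm_mul_le_of_le p2 (opNorm_mul_le_of_le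
      (opNorm_mul_le_of_le hV1 hK3) ((opNorm_transpose U).trans_le hU1))) p1
    simpa using this

/-- The error bounds propagated by the iteration. -/
structure ErrorBound (σ t u v : ℝ) (Δ : Matrix m n ℝ) : Prop where
  frob_le : frob Δ ≤ 0.03 * t * σ
  row_le : ∀ i, rowNorm Δ i ≤ 0.5 * u * t * σ
  col_le : ∀ j, rowNorm Δᵀ j ≤ 0.5 * v * t * σ

/-- Bounds for the sums of the absolute values of the entries in rows and columns. -/
structure SumBound (s u v : ℝ) (S : Matrix m n ℝ) : Prop where
  row_le : ∀ i, v * ∑ j, |S i j| ≤ s * u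
  col_le : ∀ j, u * ∑ i, |S i j| ≤ s * v

theorem SumBound.opNorm_le {s u v : ℝ} {S : Matrix m n ℝ} (h : SumBound s u v S) (hs : 0 ≤ s)
    (hu : 0 < u) (hv : 0 < v) : ‖S‖ ≤ s :=
  opNorm_le_of_sum_abs_le hs hu hv h.row_le h.col_le

theorem SumBound.transpose {s u v : ℝ} {S : Matrix m n ℝ} (h : SumBound s u v S) :
    SumBound s v u Sᵀ :=
  ⟨h.col_le, h.row_le⟩

theorem le_of_sqrt_card_mul_le {s a : ℝ} (hs : 0 ≤ s) (hr : 1 ≤ Fintype.card r)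
    (h : √(Fintype.card r) * s ≤ a) : s ≤ a := by
  refine le_trans ?_ h
  have : (1 : ℝ) ≤ √(Fintype.card r) := Real.one_le_sqrt.2 (by exact_mod_cast hr)
  nlinarith

variable {σ : ℝ} {Xs X : Matrix m n ℝ} {U : Matrix m r ℝ} {V : Matrix n r ℝ}
  {P : Matrix m m ℝ} {Q : Matrix n n ℝ} {Gs G : Matrix n m ℝ}

/-- One step of the iteration contracts the error. -/
theorem LowRankPair.errorBound_step (h : LowRankPair σ Xs X U V P Q Gs G) {η s t u v : ℝ}
    (hη : η ∈ Set.Icc (1 / 4 : ℝ) (2 / 3)) (ht : t ≤ 1) (ht0 : 0 < t) (hu0 : 0 < u) (hv0 : 0 < v)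
    (hu : ∀ i, rowNorm U i ≤ u) (hv : ∀ j, rowNorm V j ≤ v) (hX : ErrorBound σ t u v (X - Xs))
    {S : Matrix m n ℝ} (hS : SumBound s u v S) (hs0 : 0 ≤ s) (hr : 1 ≤ Fintype.card r)
    (hs : √(Fintype.card r) * s ≤ 6e-4 * t * σ) :
    ErrorBound σ ((1 - 0.6 * η) * t) u v (X - η • ((X - Xs + S) * Q) - η • (P * (X - Xs + S))
      + η ^ 2 • ((X - Xs + S) * G * (X - Xs + S)) - Xs) := by
  have hS' := hS.opNorm_le hs0 hu0 hv0
  have hs' := le_of_sqrt_card_mul_le hs0 hr hs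
  have hF := (opNorm_le_frob _).trans hX.frob_le
  have hP : ∀ i, rowNorm P i ≤ 1.6 * u := fun i => h.rowNorm_left_le (hu i) ht (hX.row_le i)
  have hQ : ∀ j, rowNorm Q j ≤ 1.6 * v := fun j =>
    h.transpose.rowNorm_left_le (hv j) ht (hX.col_le j)
  refine ⟨h.frob_step_le hη ht ht0 hS' hr hs hX.frob_le, fun i => ?_, fun j => ?_⟩
  · exact h.rowNorm_step_le hη ht ht0 hS' hs' hF (hu i) (hX.row_le i) hQ (hS.row_le i)
  · have key := h.transpose.rowNorm_step_le hη ht ht0 ((opNorm_transpose S).trans_le hS') hs'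
      (by rwa [← transpose_sub, opNorm_transpose]) (hv j) (hX.col_le j) hP (hS.col_le j)
    convert key using 2
    simp only [transpose_add, transpose_sub, transpose_smul, transpose_mul, h.left_symm,
      h.right_symm, Matrix.mul_assoc]
    abel

/-- At the start no row bound on `X - Xs` is known. Instead `P = X * G = Xs * G + (S * Q) * G`,
where `S * Q` is controlled by the incoherence `q` of `Q`, with a tiny coefficient. -/
theorem LowRankPair.rowNorm_left_le_of_init (h : LowRankPair σ Xs X U V P Q Gs G) {s u v q : ℝ}
    {S : Matrix m n ℝ} (hXQ : (Xs + S) * Q = X) (hu0 : 0 < u)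
    (hu : ∀ i, rowNorm U i ≤ u) (hrow : ∀ i, v * ∑ j, |S i j| ≤ s * u) (hq : 0 ≤ q)
    (hs : s ≤ 3e-4 * σ) (hQ : ∀ j, rowNorm Q j ≤ q * v) (i : m) :
    rowNorm P i ≤ (1.04 + 0.001 * q) * u := by
  have hσ := h.pos
  have e1 : Xs * G = P - (X - Xs) * G := by rw [Matrix.sub_mul, h.mul_pinv]; simp
  have e2 : P = U * (Uᵀ * (P - (X - Xs) * G)) + (S * Q) * G := by
    rw [← e1, ← Matrix.mul_assoc, ← Matrix.mul_assoc, h.left_mul, Matrix.mul_assoc S, h.right_pinv,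
      ← Matrix.add_mul]
    conv_rhs => rw [← h.right_pinv, ← Matrix.mul_assoc, hXQ]
    exact h.mul_pinv.symm
  have k : 0.03 * σ * (1 / (0.97 * σ)) ≤ 0.031 := by
    rw [mul_one_div, div_le_iff₀ (by positivity)]; nlinarith
  have b1 : ‖(X - Xs) * G‖ ≤ 0.031 := (opNorm_mul_le_of_le h.near h.pinv_norm).trans k
  have b2 : ‖Uᵀ * (P - (X - Xs) * G)‖ ≤ 1 * 1.031 := by
    refine opNorm_mul_le_of_le ((opNorm_transpose U).trans_le h.opNorm_left_basis) ?_
    have := norm_sub_le P ((X - Xs) * G)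
    have := h.opNorm_left
    linarith
  have b3 := rowNorm_mul_le_of_le (hu i) b2
  have b4 : rowNorm (S * Q) i ≤ 3e-4 * (σ * q * u) := by
    refine (rowNorm_mul_le_of_forall_le S hQ i).trans ?_
    have h1 := mul_le_mul_of_nonneg_left (hrow i) hq
    have h2 := mul_le_mul_of_nonneg_right hs (mul_nonneg hq hu0.le)
    linarith
  have b5 := rowNorm_mul_le_of_le b4 h.pinv_norm
  have b6 : 3e-4 * (σ * q * u) * (1 / (0.97 * σ)) ≤ 0.001 * (q * u) := by
    rw [mul_one_div, div_le_iff₀ (by positivity)]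
    have : 0 ≤ σ * q * u := by positivity
    linarith
  have b7 := rowNorm_add_le (U * (Uᵀ * (P - (X - Xs) * G))) ((S * Q) * G) i
  rw [← e2] at b7
  linarith

/-- For the largest normalized row norms p of `P` and q of `Q`, the preceding bound and its
transpose give p ≤ 1.04 + 0.001q and q ≤ 1.04 + 0.001p, a system that closes. -/
theorem LowRankPair.rowNorm_le_of_init (h : LowRankPair σ Xs X U V P Q Gs G) {s u v : ℝ}
    {S : Matrix m n ℝ} (hXP : P * (Xs + S) = X) (hXQ : (Xs + S) * Q = X) (hu0 : 0 < u)
    (hv0 : 0 < v) (hu : ∀ i, rowNorm U i ≤ u) (hv : ∀ j, rowNorm V j ≤ v) (hS : SumBound s u v S)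
    (hs : s ≤ 3e-4 * σ) [Nonempty m] [Nonempty n] :
    (∀ i, rowNorm P i ≤ 1.6 * u) ∧ (∀ j, rowNorm Q j ≤ 1.6 * v) := by
  obtain ⟨i₀, hi₀⟩ := Finite.exists_max (rowNorm P)
  obtain ⟨j₀, hj₀⟩ := Finite.exists_max (rowNorm Q)
  have hXP' : (Xsᵀ + Sᵀ) * P = Xᵀ := by
    rw [← h.left_symm, ← transpose_add, ← transpose_mul, hXP]
  have p := h.rowNorm_left_le_of_init hXQ hu0 hu hS.row_le
    (div_nonneg (rowNorm_nonneg Q j₀) hv0.le) hs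
    (fun j => by rw [div_mul_cancel₀ _ hv0.ne']; exact hj₀ j) i₀
  have q := h.transpose.rowNorm_left_le_of_init hXP' hv0 hv hS.col_le
    (div_nonneg (rowNorm_nonneg P i₀) hu0.le) hs
    (fun i => by rw [div_mul_cancel₀ _ hu0.ne']; exact hi₀ i) j₀
  rw [← div_le_iff₀ hu0] at p
  rw [← div_le_iff₀ hv0] at q
  constructor
  · intro i
    refine (hi₀ i).trans ?_
    rw [← div_le_iff₀ hu0]
    linarith
  · intro j
    refine (hj₀ j).trans ?_
    rw [← div_le_iff₀ hv0]
    linarith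

theorem LowRankPair.rowNorm_sub_le_of_init (h : LowRankPair σ Xs X U V P Q Gs G) {s u v : ℝ}
    {S : Matrix m n ℝ} (hXQ : (Xs + S) * Q = X) (hu0 : 0 < u)
    (hu : ∀ i, rowNorm U i ≤ u) (hrow : ∀ i, v * ∑ j, |S i j| ≤ s * u)
    (hs : s ≤ 3e-4 * σ) (hX : ‖X - Xs‖ ≤ 2 * s) (hQ : ∀ j, rowNorm Q j ≤ 1.6 * v) (i : m) :
    rowNorm (X - Xs) i ≤ 0.5 * u * 1 * σ := by
  have hσ := h.pos
  -- `(X - Xs) * Q = S * Q` because `X * Q = X = (Xs + S) * Q`.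
  have e : X - Xs = S * Q + (X - Xs) * (1 - Q) := by
    rw [Matrix.mul_sub, Matrix.mul_one, Matrix.sub_mul, h.right_proj]
    nth_rewrite 3 [← hXQ]
    rw [Matrix.add_mul]
    abel
  have b1 := h.rowNorm_mul_compl_right_le (hu i) hX
  have b2 : rowNorm (S * Q) i ≤ 1.6 * (s * u) := by
    have := rowNorm_mul_le_of_forall_le S hQ i
    have := hrow i
    nlinarith
  have b3 := rowNorm_add_le (S * Q) ((X - Xs) * (1 - Q)) i
  rw [← e] at b3
  have b4 := mul_le_mul_of_nonneg_right hs hu0.le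
  have b5 : 0 < σ * u := by positivity
  linarith

/-- The error bounds hold initially. -/
theorem LowRankPair.errorBound_init (h : LowRankPair σ Xs X U V P Q Gs G) {s u v : ℝ}
    {S : Matrix m n ℝ} (hXP : P * (Xs + S) = X) (hXQ : (Xs + S) * Q = X) (hu0 : 0 < u)
    (hv0 : 0 < v) (hu : ∀ i, rowNorm U i ≤ u) (hv : ∀ j, rowNorm V j ≤ v) (hS : SumBound s u v S)
    (hs0 : 0 ≤ s) (hr : 1 ≤ Fintype.card r) (hs : √(Fintype.card r) * s ≤ 3e-4 * σ)
    (hX : ‖X - Xs‖ ≤ 2 * s) [Nonempty m] [Nonempty n] : ErrorBound σ 1 u v (X - Xs) := by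
  have hs' := le_of_sqrt_card_mul_le hs0 hr hs
  obtain ⟨hP, hQ⟩ := h.rowNorm_le_of_init hXP hXQ hu0 hv0 hu hv hS hs'
  have hXP' : (Xsᵀ + Sᵀ) * P = Xᵀ := by
    rw [← h.left_symm, ← transpose_add, ← transpose_mul, hXP]
  have hσ := h.pos
  refine ⟨?_, h.rowNorm_sub_le_of_init hXQ hu0 hu hS.row_le hs' hX hQ, ?_⟩
  -- `(1 - P) * (X - Xs) = -(1 - P) * Xs` has row space inside that of `V`. Both summands have rank
  -- at most card r, so an operator norm of 2s gives a Frobenius norm of at most 4√(card r)·s.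
  · have e : X - Xs = P * (X - Xs) + ((1 - P) * (X - Xs) * V) * Vᵀ := by
      have e1 : (1 - P) * (X - Xs) = -((1 - P) * Xs) := by rw [h.compl_left_mul, neg_neg]
      rw [e1, Matrix.mul_assoc _ V, Matrix.neg_mul, Matrix.mul_assoc _ Xs, h.mul_right,
        h.compl_left_mul, neg_neg, Matrix.sub_mul, Matrix.one_mul]
      abel
    have hV : frob Vᵀ = √(Fintype.card r) := by rw [frob_transpose, frob_eq_sqrt_card h.right_iso]
    have b1 := frob_mul_le_of_le h.left_frob hX
    have b2 : ‖(1 - P) * (X - Xs) * V‖ ≤ 1 * (2 * s) * 1 :=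
      opNorm_mul_le_of_le (opNorm_mul_le_of_le h.opNorm_left_compl hX) h.transpose.opNorm_left_basis
    have b3 := frob_mul_le_of_le' b2 hV.le
    have b4 := frob_add_le (P * (X - Xs)) (((1 - P) * (X - Xs) * V) * Vᵀ)
    rw [← e] at b4
    linarith
  · intro j
    have := h.transpose.rowNorm_sub_le_of_init hXP' hv0 hv hS.col_le hs'
      (by rwa [← transpose_sub, opNorm_transpose]) hP j
    rwa [transpose_sub]

end Dynamics

/-! ### Block circulant matrices: from tensors to real matrices. -/

section BlockCirculant

set_option linter.unusedSectionVars false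

variable {I J K n : ℕ} [NeZero n]

/-- The block circulant matrix of a tensor. -/
def blockCirc (A : Tensor I J n) : Matrix (Fin I × ZMod n) (Fin J × ZMod n) ℝ :=
  Matrix.of fun p q => A p.1 q.1 (p.2 - q.2)

theorem blockCirc_apply (A : Tensor I J n) (p : Fin I × ZMod n) (q : Fin J × ZMod n) :
    blockCirc A p q = A p.1 q.1 (p.2 - q.2) := rfl

theorem blockCirc_injective : Function.Injective (blockCirc (I := I) (J := J) (n := n)) := by
  intro A B h
  funext i j t
  have := congrFun (congrFun h (i, t)) (j, 0)
  simpa [blockCirc_apply] using this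

theorem blockCirc_tProd (A : Tensor I J n) (B : Tensor J K n) :
    blockCirc (A ∗ₜ B) = blockCirc A * blockCirc B := by
  ext p q
  simp only [blockCirc_apply, mul_apply, tProd, Fintype.sum_prod_type]
  refine Finset.sum_congr rfl fun j _ => ?_
  refine Fintype.sum_equiv (Equiv.subLeft p.2) _ _ fun s => ?_
  simp only [Equiv.subLeft_apply, sub_sub_cancel]
  congr 2
  abel

theorem blockCirc_tTranspose (A : Tensor I J n) : blockCirc Aᵗ = (blockCirc A)ᵀ := by
  ext p q
  simp [blockCirc_apply, tTranspose]

theorem blockCirc_tId : blockCirc (tId I n) = 1 := by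
  ext p q
  simp [blockCirc_apply, tId, one_apply, Prod.ext_iff, sub_eq_zero]

theorem blockCirc_sub (A B : Tensor I J n) : blockCirc (A - B) = blockCirc A - blockCirc B := rfl

theorem blockCirc_add (A B : Tensor I J n) : blockCirc (A + B) = blockCirc A + blockCirc B := rfl

theorem blockCirc_smul (c : ℝ) (A : Tensor I J n) : blockCirc (c • A) = c • blockCirc A := rfl

/-- The inverse of a block circulant matrix is block circulant. -/
theorem exists_blockCirc_eq_inv {A : Tensor I I n} :
    ∃ B : Tensor I I n, blockCirc B = (blockCirc A)⁻¹ := by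
  refine ⟨fun i j t => (blockCirc A)⁻¹ (i, t) (j, 0), ?_⟩
  ext p q
  let e : Fin I × ZMod n ≃ Fin I × ZMod n := (Equiv.refl _).prodCongr (Equiv.addRight q.2)
  -- Block circulant means invariant under simultaneous cyclic shifts of rows and columns, a
  -- property that passes to the inverse. So the column block with third index 0 determines the
  -- inverse.
  have h : (blockCirc A).submatrix e e = blockCirc A := by
    ext a b
    simp [blockCirc_apply, e]
  have h2 := inv_submatrix_equiv (blockCirc A) e e
  rw [h] at h2
  have h3 := congrFun (congrFun h2 (p.1, p.2 - q.2)) (q.1, 0)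
  rw [blockCirc_apply]
  simpa [e] using h3

theorem tInvertible_of_isUnit {A : Tensor I I n} (h : IsUnit (blockCirc A)) :
    TInvertible A := by
  obtain ⟨B, hB⟩ := exists_blockCirc_eq_inv (A := A)
  have hd := (isUnit_iff_isUnit_det _).1 h
  refine ⟨B, blockCirc_injective ?_, blockCirc_injective ?_⟩
  · rw [blockCirc_tProd, hB, mul_nonsing_inv _ hd, blockCirc_tId]
  · rw [blockCirc_tProd, hB, nonsing_inv_mul _ hd, blockCirc_tId]

theorem blockCirc_tInv {A : Tensor I I n} (h : TInvertible A) :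
    blockCirc (tInv A) = (blockCirc A)⁻¹ := by
  have h1 : IsTInverse A (tInv A) := by
    rw [tInv, dif_pos h]
    exact h.choose_spec
  have h2 := congrArg blockCirc h1.1
  rw [blockCirc_tProd, blockCirc_tId] at h2
  exact (inv_eq_right_inv h2).symm

theorem rowNorm_blockCirc_sq (A : Tensor I J n) (p : Fin I × ZMod n) :
    rowNorm (blockCirc A) p ^ 2 = ∑ j, ∑ t, A p.1 j t ^ 2 := by
  rw [rowNorm_sq, Fintype.sum_prod_type]
  refine Finset.sum_congr rfl fun j _ => ?_
  exact Fintype.sum_equiv (Equiv.subLeft p.2) _ _ fun s => rfl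

theorem rowNorm_blockCirc_le (A : Tensor I J n) (p : Fin I × ZMod n) :
    rowNorm (blockCirc A) p ≤ twoInfNorm A := by
  have h : rowNorm (blockCirc A) p = √(∑ j, ∑ t, A p.1 j t ^ 2) := by
    rw [← rowNorm_blockCirc_sq, Real.sqrt_sq (rowNorm_nonneg _ _)]
  rw [h]
  exact le_ciSup (f := fun i => √(∑ j, ∑ t, A i j t ^ 2)) (Set.finite_range _).bddAbove p.1

/-- Every horizontal slice occurs as n rows. This is the origin of 1/√I₃ in the theorem. -/
theorem frob_blockCirc (A : Tensor I J n) : frob (blockCirc A) = √n * frobNorm A := by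
  rw [frobNorm, ← Real.sqrt_mul (by positivity), eq_comm,
    Real.sqrt_eq_iff_mul_self_eq (by positivity) (frob_nonneg _), ← sq,
    frob_sq_eq_sum_rowNorm_sq, Fintype.sum_prod_type]
  simp only [rowNorm_blockCirc_sq, Finset.sum_const, Finset.card_univ, ZMod.card, nsmul_eq_mul]
  rw [Finset.mul_sum]

theorem abs_le_infNorm (A : Tensor I J n) (i : Fin I) (j : Fin J) (t : ZMod n) :
    |A i j t| ≤ infNorm A :=
  le_ciSup (f := fun p : Fin I × Fin J × ZMod n => |A p.1 p.2.1 p.2.2|)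
    (Set.finite_range _).bddAbove (i, j, t)

theorem infNorm_le {A : Tensor I J n} {c : ℝ} (hc : 0 ≤ c) (h : ∀ i j t, |A i j t| ≤ c) :
    infNorm A ≤ c :=
  Real.iSup_le (fun _ => h _ _ _) hc

end BlockCirculant

/-! ### Fourier slices and the operator norm of a block circulant matrix. -/

section Fourier

variable {I J K n : ℕ} [NeZero n]

open ZMod

theorem fourierSlice_apply (A : Tensor I J n) (k : ZMod n) (i : Fin I) (j : Fin J) :
    fourierSlice A k i j = ∑ t, stdAddChar (-(t * k)) * (A i j t : ℂ) := by
  simp [fourierSlice, dft_apply]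

theorem fourierSlice_injective {A B : Tensor I J n} (h : ∀ k, fourierSlice A k = fourierSlice B k) :
    A = B := by
  funext i j t
  have h1 : dft (fun t => (A i j t : ℂ)) = dft (fun t => (B i j t : ℂ)) := by
    funext k
    exact congrFun (congrFun (h k) i) j
  have h2 := congrFun (dft.injective h1) t
  exact_mod_cast h2

/-- The complex vector of Fourier coefficients of a vector. -/
noncomputable def fourierVec (x : Fin J × ZMod n → ℝ) (k : ZMod n) : Fin J → ℂ :=
  fun j => ∑ t, stdAddChar (-(t * k)) * (x (j, t) : ℂ)

theorem sum_conv (a b : ZMod n → ℂ) (k : ZMod n) :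
    ∑ t, stdAddChar (-(t * k)) * ∑ s, a s * b (t - s) =
      (∑ s, stdAddChar (-(s * k)) * a s) * ∑ t, stdAddChar (-(t * k)) * b t := by
  simp only [Finset.mul_sum, Finset.sum_mul]
  rw [Finset.sum_comm, Finset.sum_comm (f := fun i j => stdAddChar (-(j * k)) * a j *
    (stdAddChar (-(i * k)) * b i))]
  refine Finset.sum_congr rfl fun s _ => ?_
  refine Fintype.sum_equiv (Equiv.subRight s) _ _ fun t => ?_
  have : -(t * k) = -(s * k) + -((t - s) * k) := by ring
  rw [this, AddChar.map_add_eq_mul, Equiv.subRight_apply]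
  ring

theorem fourierSlice_tProd (A : Tensor I J n) (B : Tensor J K n) (k : ZMod n) :
    fourierSlice (A ∗ₜ B) k = fourierSlice A k * fourierSlice B k := by
  ext i l
  simp only [fourierSlice_apply, mul_apply, ← sum_conv, tProd]
  rw [Finset.sum_comm]
  refine Finset.sum_congr rfl fun t _ => ?_
  push_cast
  rw [Finset.mul_sum]

theorem fourierVec_blockCirc_mulVec (A : Tensor I J n) (x : Fin J × ZMod n → ℝ) (k : ZMod n) :
    fourierVec (blockCirc A *ᵥ x) k = fourierSlice A k *ᵥ fourierVec x k := by
  ext i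
  simp only [fourierVec, mulVec, dotProduct, fourierSlice_apply, ← sum_conv]
  rw [Finset.sum_comm]
  refine Finset.sum_congr rfl fun t _ => ?_
  simp only [Fintype.sum_prod_type, blockCirc_apply]
  push_cast
  rw [← Finset.mul_sum]
  congr 1
  refine Finset.sum_congr rfl fun j _ => ?_
  refine Fintype.sum_equiv (Equiv.subLeft t) _ _ fun s => ?_
  simp

theorem conj_stdAddChar (a : ZMod n) :
    (starRingEnd ℂ) (stdAddChar a) = stdAddChar (-a) := by
  rw [← AddChar.inv_apply_eq_conj, AddChar.map_neg_eq_inv]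

/-- Reversing the third index conjugates the characters, and the entries are real. -/
theorem fourierSlice_tTranspose (A : Tensor I J n) (k : ZMod n) :
    fourierSlice Aᵗ k = (fourierSlice A k)ᴴ := by
  ext j i
  simp only [fourierSlice_apply, conjTranspose_apply, tTranspose, star_sum, star_mul']
  refine Fintype.sum_equiv (Equiv.neg _) _ _ fun t => ?_
  simp only [RCLike.star_def, conj_stdAddChar, Equiv.neg_apply, Complex.conj_ofReal]
  congr 2
  ring

theorem fourierSlice_tId (k : ZMod n) : fourierSlice (tId I n) k = 1 := by
  ext i j
  rw [fourierSlice_apply, one_apply]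
  by_cases h : i = j
  · rw [if_pos h, Finset.sum_eq_single 0 (fun t _ ht => by simp [tId, ht]) (by simp)]
    simp [tId, h]
  · simp [tId, h]

theorem fourierSlice_sub (A B : Tensor I J n) (k : ZMod n) :
    fourierSlice (A - B) k = fourierSlice A k - fourierSlice B k := by
  ext i j
  simp [fourierSlice_apply, mul_sub]

/-- Parseval's identity. -/
theorem sum_norm_sq_fourier (f : ZMod n → ℂ) :
    ∑ k, ‖∑ t, stdAddChar (-(t * k)) * f t‖ ^ 2 = n * ∑ t, ‖f t‖ ^ 2 := by
  have h : ∀ t, ∑ k, stdAddChar (k * t) * dft f k = n * f t := by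
    intro t
    have := invDFT_apply (dft f) t
    rw [LinearEquiv.symm_apply_apply] at this
    rw [this]
    have hn : (n : ℂ) ≠ 0 := NeZero.ne _
    simp [hn]
  have h2 : (((∑ k, ‖dft f k‖ ^ 2 : ℝ)) : ℂ) = ((n * ∑ t, ‖f t‖ ^ 2 : ℝ) : ℂ) := by
    push_cast
    simp only [← Complex.conj_mul']
    calc ∑ k, (starRingEnd ℂ) (dft f k) * dft f k
        = ∑ k, ∑ t, (starRingEnd ℂ) (f t) * (stdAddChar (k * t) * dft f k) := by
          refine Finset.sum_congr rfl fun k _ => ?_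
          rw [dft_apply, map_sum, Finset.sum_mul]
          refine Finset.sum_congr rfl fun t _ => ?_
          rw [smul_eq_mul, map_mul, conj_stdAddChar, neg_neg, mul_comm t k]
          ring
      _ = ∑ t, (starRingEnd ℂ) (f t) * (n * f t) := by
          rw [Finset.sum_comm]
          refine Finset.sum_congr rfl fun t _ => ?_
          rw [← Finset.mul_sum, h]
      _ = n * ∑ t, (starRingEnd ℂ) (f t) * f t := by
          rw [Finset.mul_sum]
          exact Finset.sum_congr rfl fun t _ => by ring
  have h3 := Complex.ofReal_injective h2
  rw [← h3]
  simp [dft_apply]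

theorem sum_norm_sq_fourierVec (x : EuclideanSpace ℝ (Fin J × ZMod n)) :
    ∑ k, ‖WithLp.toLp 2 (fourierVec x k)‖ ^ 2 = n * ‖x‖ ^ 2 := by
  simp only [EuclideanSpace.norm_sq_eq]
  rw [Finset.sum_comm, Fintype.sum_prod_type, Finset.mul_sum]
  refine Finset.sum_congr rfl fun j _ => ?_
  have := sum_norm_sq_fourier (fun t => (x (j, t) : ℂ))
  simpa [fourierVec] using this

/-- `blockCirc A` acts on Fourier coefficients slice by slice; Parseval on both sides cancels the
factor n. -/
theorem opNorm_blockCirc_le {A : Tensor I J n} {c : ℝ} (hc : 0 ≤ c)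
    (h : ∀ k (x : EuclideanSpace ℂ (Fin J)), ‖WithLp.toLp 2 (fourierSlice A k *ᵥ x)‖ ≤ c * ‖x‖) :
    ‖blockCirc A‖ ≤ c := by
  refine opNorm_le_of_forall_mulVec hc fun x => ?_
  refine le_of_sq_le_sq ?_ (mul_nonneg hc (norm_nonneg _))
  have hn : (0 : ℝ) < n := Nat.cast_pos.2 (NeZero.pos n)
  refine le_of_mul_le_mul_left ?_ hn
  rw [← sum_norm_sq_fourierVec, mul_pow, mul_left_comm, ← sum_norm_sq_fourierVec, Finset.mul_sum]
  refine Finset.sum_le_sum fun k _ => ?_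
  rw [← mul_pow]
  refine pow_le_pow_left₀ (norm_nonneg _) ?_ 2
  have := h k (WithLp.toLp 2 (fourierVec x k))
  rwa [← fourierVec_blockCirc_mulVec] at this

theorem le_norm_blockCirc_mulVec {A : Tensor I J n} {c : ℝ} (hc : 0 ≤ c)
    (h : ∀ k (x : EuclideanSpace ℂ (Fin J)), c * ‖x‖ ≤ ‖WithLp.toLp 2 (fourierSlice A k *ᵥ x)‖)
    (x : EuclideanSpace ℝ (Fin J × ZMod n)) :
    c * ‖x‖ ≤ ‖WithLp.toLp 2 (blockCirc A *ᵥ x)‖ := by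
  refine le_of_sq_le_sq ?_ (norm_nonneg _)
  have hn : (0 : ℝ) < n := Nat.cast_pos.2 (NeZero.pos n)
  refine le_of_mul_le_mul_left ?_ hn
  rw [← sum_norm_sq_fourierVec, mul_pow, mul_left_comm, ← sum_norm_sq_fourierVec, Finset.mul_sum]
  refine Finset.sum_le_sum fun k _ => ?_
  rw [← mul_pow]
  refine pow_le_pow_left₀ (mul_nonneg hc (norm_nonneg _)) ?_ 2
  have := h k (WithLp.toLp 2 (fourierVec x k))
  rwa [← fourierVec_blockCirc_mulVec] at this

/-- Real and imaginary parts are mapped separately, so passing to complex vectors does not increase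
the norm. -/
theorem norm_sq_map_ofReal_mulVec_le {m l : Type*} [Fintype m] [Fintype l] [DecidableEq l]
    (A : Matrix m l ℝ) (z : l → ℂ) :
    ∑ i, ‖(A.map Complex.ofReal *ᵥ z) i‖ ^ 2 ≤ ‖A‖ ^ 2 * ∑ j, ‖z j‖ ^ 2 := by
  have hre : ‖WithLp.toLp 2 (A *ᵥ fun j => (z j).re)‖ ≤ _ :=
    l2_opNorm_mulVec A (WithLp.toLp 2 fun j => (z j).re)
  have him : ‖WithLp.toLp 2 (A *ᵥ fun j => (z j).im)‖ ≤ _ :=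
    l2_opNorm_mulVec A (WithLp.toLp 2 fun j => (z j).im)
  have hre2 := pow_le_pow_left₀ (norm_nonneg _) hre 2
  have him2 := pow_le_pow_left₀ (norm_nonneg _) him 2
  rw [mul_pow, EuclideanSpace.real_norm_sq_eq, EuclideanSpace.real_norm_sq_eq] at hre2 him2
  have e1 : ∀ w : ℂ, ‖w‖ ^ 2 = w.re ^ 2 + w.im ^ 2 := fun w => by
    rw [← Complex.normSq_eq_norm_sq, Complex.normSq_apply]; ring
  have e2 : ∀ i, ((A.map Complex.ofReal *ᵥ z) i).re = (A *ᵥ fun j => (z j).re) i := fun i => by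
    simp [mulVec, dotProduct]
  have e3 : ∀ i, ((A.map Complex.ofReal *ᵥ z) i).im = (A *ᵥ fun j => (z j).im) i := fun i => by
    simp [mulVec, dotProduct]
  simp only [e1, e2, e3, Finset.sum_add_distrib]
  simp only at hre2 him2
  linarith

theorem norm_fourierSlice_mulVec_le (A : Tensor I J n) (k : ZMod n)
    (x : EuclideanSpace ℂ (Fin J)) :
    ‖WithLp.toLp 2 (fourierSlice A k *ᵥ x)‖ ≤ ‖blockCirc A‖ * ‖x‖ := by
  have hn : (0 : ℝ) < n := Nat.cast_pos.2 (NeZero.pos n)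
  have hch : ∀ a : ZMod n, ‖stdAddChar a‖ = 1 := fun a => AddChar.norm_apply _ _
  -- The tensor of `x` with the k-th character is mapped to the tensor of `fourierSlice A k *ᵥ x`
  -- with the same character; tensoring multiplies norms by √n.
  have e : ∀ p : Fin I × ZMod n,
      ((blockCirc A).map Complex.ofReal *ᵥ fun q => stdAddChar (q.2 * k) * x q.1) p =
        stdAddChar (p.2 * k) * (fourierSlice A k *ᵥ x) p.1 := by
    rintro ⟨i, s⟩
    simp only [mulVec, dotProduct, Fintype.sum_prod_type, map_apply, blockCirc_apply,
      fourierSlice_apply, Finset.mul_sum, Finset.sum_mul]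
    refine Finset.sum_congr rfl fun j _ => ?_
    refine Fintype.sum_equiv (Equiv.subLeft s) _ _ fun t => ?_
    have : t * k = s * k + -((s - t) * k) := by ring
    rw [this, AddChar.map_add_eq_mul, Equiv.subLeft_apply]
    ring
  have h := norm_sq_map_ofReal_mulVec_le (blockCirc A) fun q => stdAddChar (q.2 * k) * x q.1
  simp only [e, norm_mul, hch, one_mul, Fintype.sum_prod_type, Finset.sum_const, Finset.card_univ,
    ZMod.card, nsmul_eq_mul, ← Finset.mul_sum] at h
  refine le_of_sq_le_sq ?_ (mul_nonneg (norm_nonneg _) (norm_nonneg _))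
  rw [mul_pow, EuclideanSpace.norm_sq_eq, EuclideanSpace.norm_sq_eq]
  rw [mul_left_comm] at h
  exact le_of_mul_le_mul_left h hn

end Fourier

/-! ### Rectangular diagonal matrices and isometries over ℂ. -/

section Diagonal

theorem norm_mulVec_le_of_diagonal {I J : ℕ} {A : Matrix (Fin I) (Fin J) ℂ} {c : ℝ} (hc0 : 0 ≤ c)
    (hA : ∀ (i : Fin I) (j : Fin J), (i : ℕ) ≠ j → A i j = 0)
    (hc : ∀ (i : Fin I) (j : Fin J), (i : ℕ) = j → ‖A i j‖ ≤ c)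
    (x : EuclideanSpace ℂ (Fin J)) : ‖WithLp.toLp 2 (A *ᵥ x)‖ ≤ c * ‖x‖ := by
  refine le_of_sq_le_sq ?_ (mul_nonneg hc0 (norm_nonneg _))
  rw [mul_pow, EuclideanSpace.norm_sq_eq, EuclideanSpace.norm_sq_eq]
  have h1 : ∀ i, ‖(A *ᵥ x) i‖ ^ 2 ≤ ∑ j : Fin J, if (i : ℕ) = j then c ^ 2 * ‖x j‖ ^ 2 else 0 := by
    intro i
    by_cases h : ∃ j : Fin J, (i : ℕ) = j
    · obtain ⟨j, hj⟩ := h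
      have e : (A *ᵥ x) i = A i j * x j := by
        rw [mulVec, dotProduct]
        exact Finset.sum_eq_single j (fun j' _ hne => by
          rw [hA i j' fun h => hne (Fin.ext (h.symm.trans hj)), zero_mul]) (by simp)
      rw [e, norm_mul, mul_pow]
      refine le_trans ?_ (Finset.single_le_sum (f := fun j : Fin J =>
        if (i : ℕ) = j then c ^ 2 * ‖x j‖ ^ 2 else 0) (fun j _ => by positivity)
        (Finset.mem_univ j))
      simp only [hj, if_true]
      exact mul_le_mul_of_nonneg_right (pow_le_pow_left₀ (norm_nonneg _) (hc i j hj) 2)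
        (sq_nonneg _)
    · push Not at h
      have e : (A *ᵥ x) i = 0 := by
        rw [mulVec, dotProduct]
        exact Finset.sum_eq_zero fun j _ => by rw [hA i j (h j), zero_mul]
      rw [e]
      simp only [norm_zero, ne_eq, OfNat.ofNat_ne_zero, not_false_eq_true, zero_pow]
      exact Finset.sum_nonneg fun j _ => by positivity
  refine (Finset.sum_le_sum fun i _ => h1 i).trans ?_
  rw [Finset.sum_comm, Finset.mul_sum]
  refine Finset.sum_le_sum fun j _ => ?_
  by_cases h : ∃ i : Fin I, (i : ℕ) = j
  · obtain ⟨i, hi⟩ := h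
    rw [Finset.sum_eq_single i (fun i' _ hne => if_neg fun h => hne (Fin.ext (h.trans hi.symm)))
      (by simp), if_pos hi]
  · push Not at h
    rw [Finset.sum_eq_zero fun i _ => if_neg (h i)]
    positivity

theorem le_norm_diagonal_mulVec {R : ℕ} {d : Fin R → ℂ} {c : ℝ} (hc0 : 0 ≤ c)
    (hc : ∀ i, c ≤ ‖d i‖) (x : EuclideanSpace ℂ (Fin R)) :
    c * ‖x‖ ≤ ‖WithLp.toLp 2 (diagonal d *ᵥ x)‖ := by
  refine le_of_sq_le_sq ?_ (norm_nonneg _)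
  rw [mul_pow, EuclideanSpace.norm_sq_eq, EuclideanSpace.norm_sq_eq, Finset.mul_sum]
  refine Finset.sum_le_sum fun i _ => ?_
  simp only [mulVec_diagonal, norm_mul, mul_pow]
  exact mul_le_mul_of_nonneg_right (pow_le_pow_left₀ hc0 (hc i) 2) (sq_nonneg _)

theorem norm_toLp_mulVec_of_isometry {m l : Type*} [Fintype m] [Fintype l] [DecidableEq l]
    {U : Matrix m l ℂ} (hU : Uᴴ * U = 1) (x : l → ℂ) :
    ‖WithLp.toLp 2 (U *ᵥ x)‖ = ‖WithLp.toLp 2 x‖ := by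
  have h : star (U *ᵥ x) ⬝ᵥ (U *ᵥ x) = star x ⬝ᵥ x := by
    rw [star_mulVec, ← dotProduct_mulVec, mulVec_mulVec, hU, one_mulVec]
  have e : ∀ {k : Type _} [Fintype k] (y : k → ℂ),
      star y ⬝ᵥ y = ((‖WithLp.toLp 2 y‖ ^ 2 : ℝ) : ℂ) := by
    intro k _ y
    rw [EuclideanSpace.norm_sq_eq]
    simp [dotProduct, Complex.conj_mul']
  have e' : star x ⬝ᵥ x = ((‖WithLp.toLp 2 x‖ ^ 2 : ℝ) : ℂ) := by
    rw [EuclideanSpace.norm_sq_eq]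
    simp [dotProduct, Complex.conj_mul']
  rw [e, e'] at h
  exact (sq_eq_sq₀ (norm_nonneg _) (norm_nonneg _)).1 (Complex.ofReal_injective h)

end Diagonal

/-! ### Singular values and the middle factor of a t-SVD. -/

section SingularValues

variable {I J R n : ℕ} [NeZero n]

theorem fourierSlice_eq_zero {D : Tensor I J n} (h : FDiagonal D) (k : ZMod n) {i : Fin I}
    {j : Fin J} (hij : (i : ℕ) ≠ j) : fourierSlice D k i j = 0 := by
  rw [fourierSlice_apply]
  exact Finset.sum_eq_zero fun t _ => by rw [h i j t hij]; simp

theorem FourierDiagNonneg.eq_ofReal {D : Tensor I J n} (h : FourierDiagNonneg D) (k : ZMod n)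
    {i : Fin I} {j : Fin J} (hij : (i : ℕ) = j) :
    fourierSlice D k i j = ((fourierSlice D k i j).re : ℂ) :=
  Complex.ext rfl (h k i j hij).2

theorem FourierDiagNonneg.norm_eq {D : Tensor I J n} (h : FourierDiagNonneg D) (k : ZMod n)
    {i : Fin I} {j : Fin J} (hij : (i : ℕ) = j) :
    ‖fourierSlice D k i j‖ = (fourierSlice D k i j).re := by
  rw [h.eq_ofReal k hij, Complex.norm_real, Real.norm_eq_abs, abs_of_nonneg (h k i j hij).1,
    Complex.ofReal_re]

theorem fourierSlice_eq_diagonal {D : Tensor R R n} (h : FDiagonal D) (k : ZMod n) :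
    fourierSlice D k = diagonal fun r => fourierSlice D k r r := by
  ext i j
  by_cases hij : i = j
  · subst hij; simp
  · rw [diagonal_apply_ne _ hij]
    exact fourierSlice_eq_zero h k fun h => hij (Fin.ext h)

/-- Fourier slices that are real diagonal are Hermitian. For a square root `T` this makes `T ∗ₜ Tᵗ`
equal to `T ∗ₜ T`. -/
theorem tTranspose_eq_self {D : Tensor R R n} (h : FDiagonal D) (h' : FourierDiagNonneg D) :
    Dᵗ = D := by
  refine fourierSlice_injective fun k => ?_
  rw [fourierSlice_tTranspose, fourierSlice_eq_diagonal h, diagonal_conjTranspose]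
  congr 1
  funext r
  rw [Pi.star_apply, h'.eq_ofReal k rfl, Complex.star_def, Complex.conj_ofReal]

theorem fourierSlice_isometry {U : Tensor I R n} (h : Uᵗ ∗ₜ U = tId R n) (k : ZMod n) :
    (fourierSlice U k)ᴴ * fourierSlice U k = 1 := by
  rw [← fourierSlice_tTranspose, ← fourierSlice_tProd, h, fourierSlice_tId]

theorem fourierSlice_svd {A : Tensor I J n} {I' J' : ℕ} {U : Tensor I I' n} {D : Tensor I' J' n}
    {V : Tensor J J' n} (h : A = U ∗ₜ D ∗ₜ Vᵗ) (k : ZMod n) :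
    fourierSlice A k = fourierSlice U k * fourierSlice D k * (fourierSlice V k)ᴴ := by
  rw [h, fourierSlice_tProd, fourierSlice_tProd, fourierSlice_tTranspose]

theorem finite_nonzeroSingularValues (A : Tensor I J n) : (nonzeroSingularValues A).Finite := by
  refine (Set.finite_iUnion fun k : ZMod n => Set.Finite.image
    (fun i => (Matrix.toEuclideanLin (fourierSlice A k)).singularValues i)
    (Matrix.toEuclideanLin (fourierSlice A k)).singularValues.support.finite_toSet).subset ?_
  rintro s ⟨hs, k, i, rfl⟩
  refine Set.mem_iUnion.2 ⟨k, i, ?_, rfl⟩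
  exact Finsupp.mem_support_iff.2 hs

theorem pos_of_mem_nonzeroSingularValues {A : Tensor I J n} {s : ℝ}
    (hs : s ∈ nonzeroSingularValues A) : 0 < s := by
  obtain ⟨hs, k, i, rfl⟩ := hs
  exact lt_of_le_of_ne (LinearMap.singularValues_nonneg _ _) hs.symm

theorem diag_mem_nonzeroSingularValues {A : Tensor I J n} {U : Tensor I R n} {D : Tensor R R n}
    {V : Tensor J R n} (h : IsSkinnyTSVD A U D V) (k : ZMod n) (r : Fin R)
    (hr : (fourierSlice D k r r).re ≠ 0) :
    (fourierSlice D k r r).re ∈ nonzeroSingularValues A := by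
  set d := (fourierSlice D k r r).re with hd
  have hdd : fourierSlice D k r r = (d : ℂ) := h.middle.nonneg.eq_ofReal k rfl
  refine ⟨hr, k, ?_⟩
  set T := Matrix.toEuclideanLin (fourierSlice A k) with hT
  have hU := fourierSlice_isometry h.left k
  have hV := fourierSlice_isometry h.right k
  have hA := fourierSlice_svd h.eq k
  have hD := fourierSlice_eq_diagonal h.middle.fDiagonal k
  have hDe : fourierSlice D k *ᵥ Pi.single r 1 = (d : ℂ) • Pi.single r 1 := by
    rw [hD]
    ext i
    by_cases hi : i = r
    · subst hi; simp [mulVec_diagonal, hdd]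
    · simp [mulVec_diagonal, hi]
  have hDe' : (fourierSlice D k)ᴴ *ᵥ Pi.single r 1 = (d : ℂ) • Pi.single r 1 := by
    rw [← fourierSlice_tTranspose, tTranspose_eq_self h.middle.fDiagonal h.middle.nonneg, hDe]
  set w : EuclideanSpace ℂ (Fin J) := WithLp.toLp 2 (fourierSlice V k *ᵥ Pi.single r 1) with hw
  have hw0 : w ≠ 0 := by
    rw [← norm_ne_zero_iff, hw, norm_toLp_mulVec_of_isometry hV]
    rw [norm_ne_zero_iff, ne_eq, WithLp.toLp_eq_zero]
    exact fun h0 => one_ne_zero (α := ℂ) (by simpa using congrFun h0 r)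
  -- The r-th right singular vector `w` is an eigenvector of the Gram operator, with eigenvalue d².
  have hev : Module.End.HasEigenvalue (LinearMap.adjoint T ∘ₗ T) ((d ^ 2 : ℝ) : ℂ) := by
    refine Module.End.hasEigenvalue_of_hasEigenvector (x := w)
      ⟨Module.End.mem_eigenspace_iff.2 ?_, hw0⟩
    rw [hT, ← Matrix.toEuclideanLin_conjTranspose_eq_adjoint]
    apply (WithLp.ofLp_injective 2)
    simp only [LinearMap.comp_apply, Matrix.ofLp_toLpLin, toLin'_apply, WithLp.ofLp_smul, hw]
    rw [hA, conjTranspose_mul, conjTranspose_mul, conjTranspose_conjTranspose]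
    simp only [mulVec_mulVec]
    have e : (fourierSlice V k * ((fourierSlice D k)ᴴ * (fourierSlice U k)ᴴ) *
        (fourierSlice U k * fourierSlice D k * (fourierSlice V k)ᴴ * fourierSlice V k)) =
        fourierSlice V k * (fourierSlice D k)ᴴ * ((fourierSlice U k)ᴴ * fourierSlice U k) *
          fourierSlice D k * ((fourierSlice V k)ᴴ * fourierSlice V k) := by
      simp only [Matrix.mul_assoc]
    rw [e, hU, hV, Matrix.mul_one, Matrix.mul_one, ← mulVec_mulVec, hDe, mulVec_smul,
      ← mulVec_mulVec, hDe', mulVec_smul, smul_smul]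
    congr 1
    push_cast
    ring
  obtain ⟨i, hi⟩ := T.isSymmetric_adjoint_comp_self.exists_eigenvalues_eq rfl hev
  refine ⟨i, ?_⟩
  rw [T.singularValues_fin rfl]
  have : T.isSymmetric_adjoint_comp_self.eigenvalues rfl i = d ^ 2 := Complex.ofReal_injective hi
  rw [this, Real.sqrt_sq (h.middle.nonneg k r r rfl).1]

theorem diag_ne_zero_of_multiRank {A : Tensor I J n} {U : Tensor I R n} {D : Tensor R R n}
    {V : Tensor J R n} (h : IsSkinnyTSVD A U D V) (k : ZMod n) (hk : multiRank A k = R)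
    (r : Fin R) : (fourierSlice D k r r).re ≠ 0 := by
  have h1 : R ≤ (fourierSlice D k).rank := by
    rw [multiRank, fourierSlice_svd h.eq k] at hk
    exact hk.ge.trans ((rank_mul_le_left _ _).trans (rank_mul_le_right _ _))
  rw [fourierSlice_eq_diagonal h.middle.fDiagonal k, rank_diagonal] at h1
  intro h0
  have h2 : fourierSlice D k r r = 0 := by
    rw [h.middle.nonneg.eq_ofReal k rfl, h0, Complex.ofReal_zero]
  have h3 : Fintype.card {i : Fin R // fourierSlice D k i i ≠ 0} < Fintype.card (Fin R) :=
    Fintype.card_subtype_lt (x := r) (by simpa using h2)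
  rw [Fintype.card_fin] at h3
  omega

/-- If all Fourier slices have rank `R`, the middle factor of a skinny t-SVD is invertible, with
singular values between `sigmaMin` and `sigmaMax`. -/
theorem middle_bounds {A : Tensor I J n} {U : Tensor I R n} {D : Tensor R R n}
    {V : Tensor J R n} (h : IsSkinnyTSVD A U D V) (hk : ∀ k, multiRank A k = R) (hR : 1 ≤ R) :
    0 < sigmaMin A ∧ sigmaMin A ≤ sigmaMax A ∧ ‖blockCirc D‖ ≤ sigmaMax A ∧
      ∃ W, blockCirc D * W = 1 ∧ ‖W‖ ≤ 1 / sigmaMin A := by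
  have hmem : ∀ k r, (fourierSlice D k r r).re ∈ nonzeroSingularValues A := fun k r =>
    diag_mem_nonzeroSingularValues h k r (diag_ne_zero_of_multiRank h k (hk k) r)
  have hfin := finite_nonzeroSingularValues A
  have hne : (nonzeroSingularValues A).Nonempty := ⟨_, hmem 0 ⟨0, hR⟩⟩
  have hpos : 0 < sigmaMin A := pos_of_mem_nonzeroSingularValues (hne.csInf_mem hfin)
  have hmin : ∀ k r, sigmaMin A ≤ (fourierSlice D k r r).re := fun k r =>
    csInf_le hfin.bddBelow (hmem k r)
  have hmax : ∀ k r, (fourierSlice D k r r).re ≤ sigmaMax A := fun k r =>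
    le_csSup hfin.bddAbove (hmem k r)
  have hle := (hmin 0 ⟨0, hR⟩).trans (hmax 0 ⟨0, hR⟩)
  refine ⟨hpos, hle, opNorm_blockCirc_le (hpos.le.trans hle) fun k x => ?_, ?_⟩
  · refine norm_mulVec_le_of_diagonal (hpos.le.trans hle)
      (fun i j => fourierSlice_eq_zero h.middle.fDiagonal k) (fun i j hij => ?_) x
    obtain rfl := Fin.ext hij
    rw [h.middle.nonneg.norm_eq k rfl]
    exact hmax k i
  · obtain ⟨W, hW, -, hW'⟩ := exists_inverse_of_mulVec_le hpos
      (le_norm_blockCirc_mulVec (A := D) hpos.le fun k x => by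
        rw [fourierSlice_eq_diagonal h.middle.fDiagonal k]
        refine le_norm_diagonal_mulVec hpos.le (fun r => ?_) x
        rw [h.middle.nonneg.norm_eq k rfl]
        exact hmin k r)
    exact ⟨W, hW, hW'⟩

/-- The singular values beyond the `R`-th one of a tensor are at most the distance to any tensor
of tubal rank at most `R`. -/
theorem diag_le_opNorm_sub {A X : Tensor I J n} {U : Tensor I I n} {D : Tensor I J n}
    {V : Tensor J J n} (h : IsTSVD A U D V) {U' : Tensor I R n} {D' : Tensor R R n}
    {V' : Tensor J R n} (hX : X = U' ∗ₜ D' ∗ₜ V'ᵗ) (k : ZMod n) {i : Fin I} {j : Fin J}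
    (hij : (i : ℕ) = j) (hi : R ≤ i) : (fourierSlice D k i j).re ≤ ‖blockCirc (A - X)‖ := by
  set d := (fourierSlice D k i j).re with hd
  have hI : R + 1 ≤ I := by have := i.isLt; omega
  have hJ : R + 1 ≤ J := by have := j.isLt; omega
  set c : Fin (R + 1) → Fin J := Fin.castLE hJ with hc
  set B : Matrix (Fin R) (Fin (R + 1)) ℂ :=
    ((fourierSlice V' k)ᴴ * fourierSlice V k).submatrix id c with hB
  -- Among combinations of the first R + 1 right singular vectors of `A`, the R equations imposed by
  -- `V'` leave a nonzero one annihilated by `X`.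
  obtain ⟨w, hw, hw0⟩ : ∃ w : Fin (R + 1) → ℂ, B *ᵥ w = 0 ∧ w ≠ 0 := by
    have : LinearMap.ker B.mulVecLin ≠ ⊥ :=
      LinearMap.ker_ne_bot_of_finrank_lt (by simp)
    obtain ⟨w, hw, hw0⟩ := (Submodule.ne_bot_iff _).1 this
    exact ⟨w, hw, hw0⟩
  set V₁ := (fourierSlice V k).submatrix id c with hV₁
  have hV := fourierSlice_isometry h.right.1 k
  have hU := fourierSlice_isometry h.left.1 k
  have hVV₁ : (fourierSlice V k)ᴴ * V₁ = (1 : Matrix (Fin J) (Fin J) ℂ).submatrix id c := by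
    rw [← hV, hV₁]; rfl
  have hV₁V₁ : V₁ᴴ * V₁ = 1 := by
    have : V₁ᴴ * V₁ = ((fourierSlice V k)ᴴ * fourierSlice V k).submatrix c c := rfl
    rw [this, hV, submatrix_one _ (Fin.castLE_injective hJ)]
  have hX0 : fourierSlice X k *ᵥ (V₁ *ᵥ w) = 0 := by
    rw [fourierSlice_svd hX k, mulVec_mulVec, Matrix.mul_assoc _ _ V₁]
    have : (fourierSlice V' k)ᴴ * V₁ = B := rfl
    rw [this, ← mulVec_mulVec, hw, mulVec_zero]
  have hA0 : fourierSlice A k *ᵥ (V₁ *ᵥ w) =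
      fourierSlice U k *ᵥ ((fourierSlice D k).submatrix id c *ᵥ w) := by
    rw [fourierSlice_svd h.eq k, mulVec_mulVec, Matrix.mul_assoc _ _ V₁, hVV₁, mulVec_mulVec,
      Matrix.mul_assoc]
    congr 2
    have : (fourierSlice D k).submatrix id c =
      (fourierSlice D k * (1 : Matrix (Fin J) (Fin J) ℂ)).submatrix id c := by
      rw [Matrix.mul_one]
    rw [this]; rfl
  have key := norm_fourierSlice_mulVec_le (A - X) k (WithLp.toLp 2 (V₁ *ᵥ w))
  simp only at key
  rw [fourierSlice_sub, sub_mulVec, hX0, sub_zero, hA0, norm_toLp_mulVec_of_isometry hU,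
    norm_toLp_mulVec_of_isometry hV₁V₁] at key
  have hd0 : 0 ≤ d := (h.middle.nonneg k i j hij).1
  -- On these R + 1 directions the slice of `A` expands by at least `d`, since the diagonal is
  -- nonincreasing and `i ≥ R`.
  have low : d * ‖WithLp.toLp 2 w‖ ≤
      ‖WithLp.toLp 2 ((fourierSlice D k).submatrix id c *ᵥ w)‖ := by
    refine le_of_sq_le_sq ?_ (norm_nonneg _)
    rw [mul_pow, EuclideanSpace.norm_sq_eq, EuclideanSpace.norm_sq_eq, Finset.mul_sum]
    have h1 : ∀ r : Fin (R + 1), d ^ 2 * ‖w r‖ ^ 2 ≤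
        ‖((fourierSlice D k).submatrix id c *ᵥ w) (Fin.castLE hI r)‖ ^ 2 := by
      intro r
      have e : ((fourierSlice D k).submatrix id c *ᵥ w) (Fin.castLE hI r) =
          fourierSlice D k (Fin.castLE hI r) (c r) * w r := by
        rw [mulVec, dotProduct]
        exact Finset.sum_eq_single r (fun r' _ hne => by
          rw [submatrix_apply, id, fourierSlice_eq_zero h.middle.fDiagonal k, zero_mul]
          intro h'
          exact hne (Fin.ext h'.symm)) (by simp)
      rw [e, norm_mul, mul_pow, h.middle.nonneg.norm_eq k (by simp [hc])]
      refine mul_le_mul_of_nonneg_right (pow_le_pow_left₀ hd0 ?_ 2) (sq_nonneg _)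
      refine h.middle.antitone k _ _ _ _ (by simp [hc]) hij ?_
      have := r.isLt
      simp only [Fin.val_castLE]
      omega
    refine (Finset.sum_le_sum fun r _ => h1 r).trans ?_
    rw [← Finset.sum_image (f := fun i =>
      ‖((fourierSlice D k).submatrix id c *ᵥ w) i‖ ^ 2) (g := Fin.castLE hI)
      (fun a _ b _ hab => Fin.castLE_injective hI hab)]
    exact Finset.sum_le_sum_of_subset_of_nonneg (Finset.subset_univ _)
      fun _ _ _ => sq_nonneg _
  have hwpos : 0 < ‖WithLp.toLp 2 w‖ := by
    rw [norm_pos_iff, ne_eq, WithLp.toLp_eq_zero]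
    exact hw0
  exact le_of_mul_le_mul_right (low.trans key) hwpos

end SingularValues

/-! ### The top-`R` approximation as a compression. -/

section TopApprox

variable {I J R n : ℕ} [NeZero n]

theorem castLE_mul_transpose {m l : Type*} [Fintype m] [Fintype l] [DecidableEq m]
    [DecidableEq l] {c : l → m} (hc : Function.Injective c) :
    (1 : Matrix m m ℝ).submatrix id c * ((1 : Matrix m m ℝ).submatrix id c)ᵀ =
      diagonal (Set.indicator (Set.range c) 1) := by
  ext p q
  rw [mul_apply, diagonal_apply]
  simp only [submatrix_apply, id, transpose_apply, one_apply, mul_ite, mul_one, mul_zero]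
  by_cases hq : q ∈ Set.range c
  · obtain ⟨a, rfl⟩ := hq
    rw [Finset.sum_eq_single a (fun b _ hb => by rw [if_neg fun h => hb (hc h).symm]) (by simp)]
    by_cases hp : p = c a
    · simp [hp]
    · simp [hp]
  · rw [Finset.sum_eq_zero fun a _ => by rw [if_neg fun h => hq ⟨a, h.symm⟩]]
    by_cases hp : p = q
    · simp [hp, hq]
    · simp [hp]

/-- The top-`R` approximation is the compression of the tensor by a projection on either side, and it
is no farther (in operator norm) than any tensor of tubal rank at most `R`. -/
theorem IsTopApprox.blockCirc_spec {A X : Tensor I J n} {L : Tensor I R n} {M : Tensor J R n}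
    (h : IsTopApprox R A L M) {U' : Tensor I R n} {D' : Tensor R R n} {V' : Tensor J R n}
    (hX : X = U' ∗ₜ D' ∗ₜ V'ᵗ) :
    ‖blockCirc L * (blockCirc M)ᵀ - blockCirc A‖ ≤ ‖blockCirc (A - X)‖ ∧
    (IsUnit ((blockCirc L)ᵀ * blockCirc L) →
      colProj (blockCirc L) * blockCirc A = blockCirc L * (blockCirc M)ᵀ) ∧
    (IsUnit ((blockCirc M)ᵀ * blockCirc M) →
      blockCirc A * colProj (blockCirc M) = blockCirc L * (blockCirc M)ᵀ) := by
  obtain ⟨hI, hJ, U, D, V, T, hA, hT, rfl, rfl⟩ := h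
  set cI : Fin R × ZMod n → Fin I × ZMod n := Prod.map (Fin.castLE hI) id with hcI
  set cJ : Fin R × ZMod n → Fin J × ZMod n := Prod.map (Fin.castLE hJ) id with hcJ
  have injI : Function.Injective cI :=
    (Fin.castLE_injective hI).prodMap Function.injective_id
  have injJ : Function.Injective cJ :=
    (Fin.castLE_injective hJ).prodMap Function.injective_id
  have hUU : (blockCirc U)ᵀ * blockCirc U = 1 := by
    rw [← blockCirc_tTranspose, ← blockCirc_tProd, hA.left.1, blockCirc_tId]
  have hVV : (blockCirc V)ᵀ * blockCirc V = 1 := by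
    rw [← blockCirc_tTranspose, ← blockCirc_tProd, hA.right.1, blockCirc_tId]
  have hAe : blockCirc A = blockCirc U * blockCirc D * (blockCirc V)ᵀ := by
    rw [hA.eq, blockCirc_tProd, blockCirc_tProd, blockCirc_tTranspose]
  -- `EI` and `EJ` embed the first R coordinates; truncating `U` and `V` is right multiplication by
  -- them.
  set EI : Matrix (Fin I × ZMod n) (Fin R × ZMod n) ℝ := (1 : Matrix _ _ ℝ).submatrix id cI with hEI
  set EJ : Matrix (Fin J × ZMod n) (Fin R × ZMod n) ℝ := (1 : Matrix _ _ ℝ).submatrix id cJ with hEJ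
  set DR : Matrix (Fin R × ZMod n) (Fin R × ZMod n) ℝ := (blockCirc D).submatrix cI cJ with hDR
  have hUR : blockCirc (fun i r t => U i (Fin.castLE hI r) t : Tensor I R n) =
      blockCirc U * EI := by
    have : blockCirc U * EI = (blockCirc U * 1).submatrix id cI := rfl
    rw [this, Matrix.mul_one]; rfl
  have hVR : blockCirc (fun j r t => V j (Fin.castLE hJ r) t : Tensor J R n) =
      blockCirc V * EJ := by
    have : blockCirc V * EJ = (blockCirc V * 1).submatrix id cJ := rfl
    rw [this, Matrix.mul_one]; rfl
  have hEIEI : EIᵀ * EI = 1 := by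
    have : EIᵀ * EI = ((1 : Matrix (Fin I × ZMod n) (Fin I × ZMod n) ℝ)ᵀ * 1).submatrix cI cI := rfl
    rw [this, transpose_one, Matrix.mul_one, submatrix_one _ injI]
  have hEJEJ : EJᵀ * EJ = 1 := by
    have : EJᵀ * EJ = ((1 : Matrix (Fin J × ZMod n) (Fin J × ZMod n) ℝ)ᵀ * 1).submatrix cJ cJ := rfl
    rw [this, transpose_one, Matrix.mul_one, submatrix_one _ injJ]
  -- Being f-diagonal, `D` preserves the splitting into the first R coordinates and the others, so
  -- both truncations pass through it.
  have hDEJ : blockCirc D * EJ = EI * DR := by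
    have e1 : blockCirc D * EJ = (blockCirc D *
        (1 : Matrix (Fin J × ZMod n) (Fin J × ZMod n) ℝ)).submatrix id cJ := rfl
    have e2 : EI * DR = (EI * EIᵀ * blockCirc D).submatrix id cJ := by
      have : DR = (EIᵀ * blockCirc D).submatrix id cJ := by
        have : EIᵀ * blockCirc D =
          ((1 : Matrix (Fin I × ZMod n) (Fin I × ZMod n) ℝ)ᵀ * blockCirc D).submatrix cI id := rfl
        rw [this, transpose_one, Matrix.one_mul]; rfl
      rw [this, Matrix.mul_assoc]; rfl
    rw [e1, e2, Matrix.mul_one, castLE_mul_transpose injI]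
    ext p q
    rw [submatrix_apply, submatrix_apply, diagonal_mul, id]
    by_cases hp : p ∈ Set.range cI
    · simp [hp]
    · rw [blockCirc_apply, hA.middle.fDiagonal, mul_zero]
      intro hpq
      refine hp ⟨(q.1, p.2), Prod.ext (Fin.ext ?_) rfl⟩
      simp [hcI, hcJ] at hpq ⊢
      exact hpq.symm
  have hEID : EIᵀ * blockCirc D = DR * EJᵀ := by
    have e1 : EIᵀ * blockCirc D =
        ((1 : Matrix (Fin I × ZMod n) (Fin I × ZMod n) ℝ)ᵀ * blockCirc D).submatrix cI id := rfl
    have e2 : DR * EJᵀ = (blockCirc D * (EJ * EJᵀ)).submatrix cI id := by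
      have : DR = (blockCirc D * EJ).submatrix cI id := by
        have : blockCirc D * EJ = (blockCirc D *
        (1 : Matrix (Fin J × ZMod n) (Fin J × ZMod n) ℝ)).submatrix id cJ := rfl
        rw [this, Matrix.mul_one]; rfl
      rw [this, ← Matrix.mul_assoc]; rfl
    rw [e1, e2, transpose_one, Matrix.one_mul, castLE_mul_transpose injJ]
    ext p q
    rw [submatrix_apply, submatrix_apply, mul_diagonal, id]
    by_cases hq : q ∈ Set.range cJ
    · simp [hq]
    · rw [blockCirc_apply, hA.middle.fDiagonal, zero_mul]
      intro hpq
      refine hq ⟨(p.1, q.2), Prod.ext (Fin.ext ?_) rfl⟩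
      simp [hcI, hcJ] at hpq ⊢
      exact hpq
  have hTT : blockCirc T * (blockCirc T)ᵀ = DR := by
    rw [← blockCirc_tTranspose, tTranspose_eq_self hT.fDiagonal hT.nonneg, ← blockCirc_tProd, hT.sq]
    rfl
  have hLM : blockCirc ((fun i r t => U i (Fin.castLE hI r) t : Tensor I R n) ∗ₜ T) *
      (blockCirc ((fun j r t => V j (Fin.castLE hJ r) t : Tensor J R n) ∗ₜ T))ᵀ =
        blockCirc U * (EI * DR * EJᵀ) * (blockCirc V)ᵀ := by
    rw [blockCirc_tProd, blockCirc_tProd, hUR, hVR, ← hTT, transpose_mul, transpose_mul]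
    simp only [Matrix.mul_assoc]
  have hUEI : (blockCirc U * EI)ᵀ * (blockCirc U * EI) = 1 := by
    rw [transpose_mul, Matrix.mul_assoc, ← Matrix.mul_assoc _ _ EI, hUU, Matrix.one_mul, hEIEI]
  have hVEJ : (blockCirc V * EJ)ᵀ * (blockCirc V * EJ) = 1 := by
    rw [transpose_mul, Matrix.mul_assoc, ← Matrix.mul_assoc _ _ EJ, hVV, Matrix.one_mul, hEJEJ]
  rw [hLM]
  refine ⟨?_, fun hu => ?_, fun hu => ?_⟩
  -- The approximation error is the discarded tail of `D`, whose Fourier diagonal is bounded by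
  -- `diag_le_opNorm_sub`.
  · set Dt : Tensor I J n := fun i j t => if (j : ℕ) < R then 0 else D i j t with hDt
    have e : EI * DR * EJᵀ = blockCirc D - blockCirc Dt := by
      rw [← hDEJ, Matrix.mul_assoc, castLE_mul_transpose injJ]
      ext p q
      rw [mul_diagonal, Matrix.sub_apply, blockCirc_apply, blockCirc_apply]
      by_cases hq : (q.1 : ℕ) < R
      · have : q ∈ Set.range cJ := ⟨(⟨q.1, hq⟩, q.2), rfl⟩
        simp [this, hDt, hq]
      · have : q ∉ Set.range cJ := by
          rintro ⟨a, rfl⟩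
          exact hq a.1.isLt
        simp [this, hDt, hq]
    have e2 : blockCirc U * (EI * DR * EJᵀ) * (blockCirc V)ᵀ - blockCirc A =
        -(blockCirc U * blockCirc Dt * (blockCirc V)ᵀ) := by
      rw [e, hAe, Matrix.mul_sub, Matrix.sub_mul]; abel
    rw [e2, norm_neg]
    have b : ‖blockCirc Dt‖ ≤ ‖blockCirc (A - X)‖ := by
      have hDtk : ∀ k i j, fourierSlice Dt k i j =
          if (j : ℕ) < R then 0 else fourierSlice D k i j := by
        intro k i j
        rw [fourierSlice_apply, fourierSlice_apply]
        by_cases hj : (j : ℕ) < R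
        · simp [hDt, hj]
        · simp [hDt, hj]
      refine opNorm_blockCirc_le (norm_nonneg _) fun k x =>
        norm_mulVec_le_of_diagonal (norm_nonneg _) (fun i j hij => ?_) (fun i j hij => ?_) x
      · rw [hDtk, fourierSlice_eq_zero hA.middle.fDiagonal k hij, ite_self]
      · rw [hDtk]
        split_ifs with hj
        · rw [norm_zero]; exact norm_nonneg _
        · rw [hA.middle.nonneg.norm_eq k hij]
          exact diag_le_opNorm_sub hA hX k hij (by omega)
    have := opNorm_mul_le_of_le (opNorm_mul_le_of_le
      (opNorm_le_one_of_transpose_mul_self hUU) b)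
      ((opNorm_transpose _).trans_le (opNorm_le_one_of_transpose_mul_self hVV))
    simpa using this
  · rw [blockCirc_tProd, hUR] at hu ⊢
    rw [colProj_mul_of_isometry hUEI hu, hAe, transpose_mul]
    calc blockCirc U * EI * (EIᵀ * (blockCirc U)ᵀ) * (blockCirc U * blockCirc D * (blockCirc V)ᵀ)
        = blockCirc U * EI * EIᵀ * ((blockCirc U)ᵀ * blockCirc U) * blockCirc D *
            (blockCirc V)ᵀ := by simp only [Matrix.mul_assoc]
      _ = blockCirc U * EI * (EIᵀ * blockCirc D) * (blockCirc V)ᵀ := by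
          rw [hUU]; simp only [Matrix.mul_assoc, Matrix.one_mul]
      _ = _ := by rw [hEID]; simp only [Matrix.mul_assoc]
  · rw [blockCirc_tProd _ T, hVR] at hu ⊢
    rw [colProj_mul_of_isometry hVEJ hu, hAe, transpose_mul]
    calc blockCirc U * blockCirc D * (blockCirc V)ᵀ * (blockCirc V * EJ * (EJᵀ * (blockCirc V)ᵀ))
        = blockCirc U * blockCirc D * ((blockCirc V)ᵀ * blockCirc V) * EJ * EJᵀ *
            (blockCirc V)ᵀ := by simp only [Matrix.mul_assoc]
      _ = blockCirc U * (blockCirc D * EJ) * EJᵀ * (blockCirc V)ᵀ := by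
          rw [hVV]; simp only [Matrix.mul_assoc, Matrix.one_mul]
      _ = _ := by rw [hDEJ]; simp only [Matrix.mul_assoc]

end TopApprox

/-! ### Soft thresholding and sums over sparse rows and columns. -/

section Thresholding

set_option linter.unusedSectionVars false

variable {I J n : ℕ} [NeZero n]

theorem softThreshold_eq_zero {z : ℝ} {A : Tensor I J n} {i : Fin I} {j : Fin J} {t : ZMod n}
    (h : |A i j t| ≤ z) : softThreshold z A i j t = 0 := by
  rw [softThreshold, max_eq_left (by linarith), mul_zero]

theorem abs_softThreshold_sub_le {z : ℝ} (hz : 0 ≤ z) (A : Tensor I J n) (i : Fin I) (j : Fin J)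
    (t : ZMod n) : |softThreshold z A i j t - A i j t| ≤ z := by
  rw [softThreshold]
  generalize A i j t = a
  rcases lt_trichotomy a 0 with ha | rfl | ha
  · rw [Real.sign_of_neg ha, abs_of_neg ha, abs_le]
    rcases max_cases 0 (-a - z) with h | h <;> constructor <;> linarith
  · simpa using hz
  · rw [Real.sign_of_pos ha, abs_of_pos ha, abs_le]
    rcases max_cases 0 (a - z) with h | h <;> constructor <;> linarith

/-- Soft thresholding of a perturbed sparse tensor with a threshold above the perturbation. -/
theorem softThreshold_sub_spec {z : ℝ} {S E : Tensor I J n} (hE : ∀ i j t, |E i j t| ≤ z)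
    (i : Fin I) (j : Fin J) (t : ZMod n) :
    (S i j t = 0 → softThreshold z (S - E) i j t = 0) ∧
      |softThreshold z (S - E) i j t - S i j t| ≤ z + |E i j t| := by
  have hz : 0 ≤ z := (abs_nonneg _).trans (hE i j t)
  constructor
  · intro h
    refine softThreshold_eq_zero ?_
    simpa [h] using hE i j t
  · have h1 := abs_softThreshold_sub_le hz (S - E) i j t
    have h2 : softThreshold z (S - E) i j t - S i j t =
        (softThreshold z (S - E) i j t - (S - E) i j t) - E i j t := by
      simp only [Pi.sub_apply]; ring
    rw [h2]
    exact (abs_sub _ _).trans (by linarith)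

theorem sum_abs_le_ncard_mul {ι : Type*} [Fintype ι] {f g : ι → ℝ} {b : ℝ}
    (h0 : ∀ i, g i = 0 → f i = 0) (hf : ∀ i, |f i| ≤ b) :
    ∑ i, |f i| ≤ ({i | g i ≠ 0}.ncard : ℝ) * b := by
  classical
  have h1 : ∑ i, |f i| = ∑ i ∈ Finset.univ.filter (fun i => g i ≠ 0), |f i| := by
    rw [Finset.sum_filter]
    refine Finset.sum_congr rfl fun i _ => ?_
    split_ifs with h
    · rfl
    · rw [h0 i (not_not.1 h), abs_zero]
  rw [h1]
  refine (Finset.sum_le_card_nsmul _ _ b fun i _ => hf i).trans (le_of_eq ?_)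
  rw [nsmul_eq_mul]
  congr 2
  rw [← Set.ncard_coe_finset]
  congr 1
  ext i
  simp

/-- A row has at most αJn nonzero entries of size at most buv. Since Iu² = Jv² = ρ, weighting rows
by v and columns by u produces one constant αnρb for both, as the Schur test needs. -/
theorem TSparse.sumBound {α : ℝ} {S Z : Tensor I J n} (h : TSparse α S)
    (h0 : ∀ i j t, S i j t = 0 → Z i j t = 0) {b u v ρ : ℝ} (hu : 0 ≤ u) (hv : 0 ≤ v)
    (hb : 0 ≤ b) (hZ : ∀ i j t, |Z i j t| ≤ b * (u * v)) (hur : I * u ^ 2 = ρ) (hvr : J * v ^ 2 = ρ) :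
    SumBound (α * n * ρ * b) u v (blockCirc Z) := by
  have hB : 0 ≤ b * (u * v) := by positivity
  constructor
  · intro p
    have h1 : ∑ q, |blockCirc Z p q| = ∑ q : Fin J × ZMod n, |Z p.1 q.1 q.2| := by
      rw [Fintype.sum_prod_type, Fintype.sum_prod_type]
      refine Finset.sum_congr rfl fun j _ => ?_
      exact Fintype.sum_equiv (Equiv.subLeft p.2) _ _ fun s => rfl
    have h2 := sum_abs_le_ncard_mul (f := fun q : Fin J × ZMod n => Z p.1 q.1 q.2)
      (g := fun q => S p.1 q.1 q.2) (fun q => h0 _ _ _) (fun q => hZ _ _ _)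
    have h3 := mul_le_mul_of_nonneg_right (h.1 p.1) hB
    rw [h1]
    calc v * ∑ q : Fin J × ZMod n, |Z p.1 q.1 q.2| ≤ v * (α * (J * n) * (b * (u * v))) :=
          mul_le_mul_of_nonneg_left (h2.trans h3) hv
      _ = α * n * (J * v ^ 2) * b * u := by ring
      _ = _ := by rw [hvr]
  · intro q
    have h1 : ∑ p, |blockCirc Z p q| = ∑ p : Fin I × ZMod n, |Z p.1 q.1 p.2| := by
      rw [Fintype.sum_prod_type, Fintype.sum_prod_type]
      refine Finset.sum_congr rfl fun i _ => ?_
      exact Fintype.sum_equiv (Equiv.subRight q.2) _ _ fun s => rfl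
    have h2 := sum_abs_le_ncard_mul (f := fun p : Fin I × ZMod n => Z p.1 q.1 p.2)
      (g := fun p => S p.1 q.1 p.2) (fun q => h0 _ _ _) (fun q => hZ _ _ _)
    have h3 := mul_le_mul_of_nonneg_right (h.2.1 q.1) hB
    rw [h1]
    calc u * ∑ p : Fin I × ZMod n, |Z p.1 q.1 p.2| ≤ u * (α * (I * n) * (b * (u * v))) :=
          mul_le_mul_of_nonneg_left (h2.trans h3) hu
      _ = α * n * (I * u ^ 2) * b * v := by ring
      _ = _ := by rw [hur]

end Thresholding

/-! ### The gradient step for the product of the factors. -/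

section Update

variable {I J R n : ℕ} [NeZero n]

/-- The inverse Gram matrices turn the first-order terms into projections and the second-order term
into E·(pseudoinverse)·E. -/
theorem blockCirc_update {L L' : Tensor I R n} {M M' : Tensor J R n} {E : Tensor I J n} {η : ℝ}
    (hL : L' = L - η • (E ∗ₜ M ∗ₜ tInv (Mᵗ ∗ₜ M))) (hM : M' = M - η • (Eᵗ ∗ₜ L ∗ₜ tInv (Lᵗ ∗ₜ L)))
    (iL : TInvertible (Lᵗ ∗ₜ L)) (iM : TInvertible (Mᵗ ∗ₜ M)) :
    blockCirc L' * (blockCirc M')ᵀ = blockCirc L * (blockCirc M)ᵀ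
      - η • (blockCirc E * colProj (blockCirc M)) - η • (colProj (blockCirc L) * blockCirc E)
      + η ^ 2 • (blockCirc E * (blockCirc M * ((blockCirc M)ᵀ * blockCirc M)⁻¹ *
          (((blockCirc L)ᵀ * blockCirc L)⁻¹ * (blockCirc L)ᵀ)) * blockCirc E) := by
  have hL' : blockCirc L' = blockCirc L -
      η • (blockCirc E * blockCirc M * ((blockCirc M)ᵀ * blockCirc M)⁻¹) := by
    rw [hL, blockCirc_sub, blockCirc_smul, blockCirc_tProd, blockCirc_tProd, blockCirc_tInv iM,
      blockCirc_tProd, blockCirc_tTranspose]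
  have hM' : blockCirc M' = blockCirc M -
      η • ((blockCirc E)ᵀ * blockCirc L * ((blockCirc L)ᵀ * blockCirc L)⁻¹) := by
    rw [hM, blockCirc_sub, blockCirc_smul, blockCirc_tProd, blockCirc_tProd, blockCirc_tInv iL,
      blockCirc_tProd, blockCirc_tTranspose, blockCirc_tTranspose]
  rw [hL', hM', transpose_sub, transpose_smul, transpose_mul, transpose_mul, transpose_transpose,
    transpose_gram_inv, colProj, colProj, pow_two]
  simp only [Matrix.sub_mul, Matrix.mul_sub, Matrix.smul_mul, Matrix.mul_smul, Matrix.mul_assoc,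
    mul_smul]
  module

end Update

/-! ### Assembling the estimates for the algorithm. -/

section Recovery

variable {I J R n : ℕ} [NeZero n]

/-- The constants of the analysis: a `μ`-incoherent tensor `X` with a well-conditioned skinny t-SVD
and an `α`-sparse tensor `S`, with `u = √(μ R / I)`, `v = √(μ R / J)`. -/
structure RecoveryData (R : ℕ) (X S : Tensor I J n) (U : Tensor I R n) (D : Tensor R R n)
    (V : Tensor J R n) (W : Matrix (Fin R × ZMod n) (Fin R × ZMod n) ℝ) (σ κ u v ρ α : ℝ) :
    Prop where
  rank_pos : 1 ≤ R
  left_pos : 1 ≤ I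
  right_pos : 1 ≤ J
  pos : 0 < σ
  one_le : 1 ≤ κ
  u_pos : 0 < u
  v_pos : 0 < v
  u_sq : I * u ^ 2 = ρ
  v_sq : J * v ^ 2 = ρ
  svd : IsSkinnyTSVD X U D V
  inv : blockCirc D * W = 1
  inv_norm : ‖W‖ ≤ 1 / σ
  middle_norm : ‖blockCirc D‖ ≤ κ * σ
  left_le : ∀ p, rowNorm (blockCirc U) p ≤ u
  right_le : ∀ q, rowNorm (blockCirc V) q ≤ v
  sparse : TSparse α S
  nonneg : 0 ≤ α * n * ρ
  small : √(Fintype.card (Fin R × ZMod n)) * (α * n * ρ) * κ ≤ 1e-4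

namespace RecoveryData

variable {X S : Tensor I J n} {U : Tensor I R n} {D : Tensor R R n} {V : Tensor J R n}
  {W : Matrix (Fin R × ZMod n) (Fin R × ZMod n) ℝ} {σ κ u v ρ α : ℝ}

theorem card_pos (h : RecoveryData R X S U D V W σ κ u v ρ α) :
    1 ≤ Fintype.card (Fin R × ZMod n) := by
  have : Nonempty (Fin R) := ⟨⟨0, h.rank_pos⟩⟩
  exact Fintype.card_pos

theorem blockCirc_eq (h : RecoveryData R X S U D V W σ κ u v ρ α) :
    blockCirc X = blockCirc U * blockCirc D * (blockCirc V)ᵀ := by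
  rw [h.svd.eq, blockCirc_tProd, blockCirc_tProd, blockCirc_tTranspose]

theorem left_iso (h : RecoveryData R X S U D V W σ κ u v ρ α) :
    (blockCirc U)ᵀ * blockCirc U = 1 := by
  rw [← blockCirc_tTranspose, ← blockCirc_tProd, h.svd.left, blockCirc_tId]

theorem right_iso (h : RecoveryData R X S U D V W σ κ u v ρ α) :
    (blockCirc V)ᵀ * blockCirc V = 1 := by
  rw [← blockCirc_tTranspose, ← blockCirc_tProd, h.svd.right, blockCirc_tId]

/-- Through this bound the condition number enters: the initial threshold is comparable to `infNorm
X`. -/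
theorem abs_apply_le (h : RecoveryData R X S U D V W σ κ u v ρ α) (i : Fin I) (j : Fin J)
    (t : ZMod n) : |X i j t| ≤ u * v * (κ * σ) := by
  have h1 := abs_mul_apply_le (blockCirc U * blockCirc D) (blockCirc V)ᵀ (i, t) (j, 0)
  rw [← h.blockCirc_eq, blockCirc_apply, transpose_transpose] at h1
  simp only [sub_zero] at h1
  have h2 := rowNorm_mul_le_of_le (h.left_le (i, t)) h.middle_norm
  have h3 := mul_le_mul h2 (h.right_le (j, 0)) (rowNorm_nonneg _ _)
    ((rowNorm_nonneg _ _).trans h2)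
  linarith

theorem pair (h : RecoveryData R X S U D V W σ κ u v ρ α) {L : Tensor I R n} {M : Tensor J R n}
    (hnear : ‖blockCirc L * (blockCirc M)ᵀ - blockCirc X‖ ≤ 0.03 * σ) :
    IsUnit ((blockCirc L)ᵀ * blockCirc L) ∧ IsUnit ((blockCirc M)ᵀ * blockCirc M) ∧
      LowRankPair σ (blockCirc X) (blockCirc L * (blockCirc M)ᵀ) (blockCirc U) (blockCirc V)
        (colProj (blockCirc L)) (colProj (blockCirc M)) (blockCirc V * W * (blockCirc U)ᵀ)
        (blockCirc M * ((blockCirc M)ᵀ * blockCirc M)⁻¹ *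
          (((blockCirc L)ᵀ * blockCirc L)⁻¹ * (blockCirc L)ᵀ)) := by
  rw [h.blockCirc_eq] at hnear ⊢
  exact LowRankPair.of_factors h.pos h.left_iso h.right_iso h.inv h.inv_norm hnear

theorem tInvertible_gram {L : Tensor I R n} (h : IsUnit ((blockCirc L)ᵀ * blockCirc L)) :
    TInvertible (Lᵗ ∗ₜ L) := by
  refine tInvertible_of_isUnit ?_
  rwa [blockCirc_tProd, blockCirc_tTranspose]

theorem errorBound_zero (h : RecoveryData R X S U D V W σ κ u v ρ α) {S₀ : Tensor I J n}
    {L : Tensor I R n} {M : Tensor J R n} {z : ℝ} (hz : infNorm X ≤ z) (hz' : z ≤ 2 * infNorm X)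
    (hS : S₀ = softThreshold z (X + S)) (hLM : IsTopApprox R (X + S - S₀) L M) :
    ErrorBound σ 1 u v (blockCirc L * (blockCirc M)ᵀ - blockCirc X) := by
  have : Nonempty (Fin I) := ⟨⟨0, h.left_pos⟩⟩
  have : Nonempty (Fin J) := ⟨⟨0, h.right_pos⟩⟩
  have hσ := h.pos
  have hu := h.u_pos
  have hv := h.v_pos
  have hκ : 0 < κ := one_pos.trans_le h.one_le
  have hinf : infNorm X ≤ u * v * (κ * σ) := infNorm_le (by positivity) h.abs_apply_le
  have hXz : ∀ i j t, |(-X) i j t| ≤ z := fun i j t => by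
    rw [Pi.neg_apply, Pi.neg_apply, Pi.neg_apply, abs_neg]
    exact (abs_le_infNorm X i j t).trans hz
  have hS' : S₀ = softThreshold z (S - -X) := by rw [hS, sub_neg_eq_add, add_comm]
  have hZ0 : ∀ i j t, S i j t = 0 → (S - S₀) i j t = 0 := fun i j t h0 => by
    rw [Pi.sub_apply, Pi.sub_apply, Pi.sub_apply, h0, hS', (softThreshold_sub_spec hXz i j t).1 h0,
      sub_zero]
  -- The 3 is the threshold, at most twice `infNorm X`, plus the perturbation `X` itself.
  have hZb : ∀ i j t, |(S - S₀) i j t| ≤ 3 * (κ * σ) * (u * v) := fun i j t => by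
    have h1 := (softThreshold_sub_spec (S := S) hXz i j t).2
    rw [← hS', abs_sub_comm, Pi.neg_apply, Pi.neg_apply, Pi.neg_apply, abs_neg] at h1
    have h2 := abs_le_infNorm X i j t
    refine h1.trans ?_
    linarith
  have hsum := h.sparse.sumBound hZ0 hu.le hv.le (by positivity) hZb h.u_sq h.v_sq
  set s := α * n * ρ * (3 * (κ * σ)) with hs
  have hs0 : 0 ≤ s := mul_nonneg h.nonneg (by positivity)
  have hcard : √(Fintype.card (Fin R × ZMod n)) * s ≤ 3e-4 * σ := by
    have e : √(Fintype.card (Fin R × ZMod n)) * s =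
      (√(Fintype.card (Fin R × ZMod n)) * (α * n * ρ) * κ) * (3 * σ) := by rw [hs]; ring
    rw [e]
    have := mul_le_mul_of_nonneg_right h.small (by positivity : 0 ≤ 3 * σ)
    linarith
  have hop := hsum.opNorm_le hs0 hu hv
  have hA : X + S - S₀ = X + (S - S₀) := by abel
  obtain ⟨h1, h2, h3⟩ := hLM.blockCirc_spec h.svd.eq
  have e1 : X + S - S₀ - X = S - S₀ := by abel
  rw [e1] at h1
  rw [hA, blockCirc_add] at h1 h2 h3
  -- One `s` for the distance from `X + S - S₀` to its approximation, one for its distance to `X`.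
  have hX : ‖blockCirc L * (blockCirc M)ᵀ - blockCirc X‖ ≤ 2 * s := by
    have e2 : blockCirc L * (blockCirc M)ᵀ - blockCirc X =
      (blockCirc L * (blockCirc M)ᵀ - (blockCirc X + blockCirc (S - S₀))) + blockCirc (S - S₀) := by
      abel
    rw [e2]
    exact (norm_add_le _ _).trans (by linarith)
  have hs' := le_of_sqrt_card_mul_le hs0 h.card_pos hcard
  obtain ⟨iL, iM, hp⟩ := h.pair (hX.trans (by linarith))
  exact hp.errorBound_init (h2 iL) (h3 iM) hu hv h.left_le h.right_le hsum hs0 h.card_pos hcard hX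

theorem near_of_errorBound (h : RecoveryData R X S U D V W σ κ u v ρ α) {t : ℝ} (ht : t ≤ 1)
    {Δ : Matrix (Fin I × ZMod n) (Fin J × ZMod n) ℝ} (hΔ : ErrorBound σ t u v Δ) :
    ‖Δ‖ ≤ 0.03 * σ := by
  have h1 := (opNorm_le_frob _).trans hΔ.frob_le
  have := h.pos
  nlinarith

theorem abs_error_le (h : RecoveryData R X S U D V W σ κ u v ρ α) {L : Tensor I R n}
    {M : Tensor J R n} {t : ℝ} (ht : t ≤ 1) (ht0 : 0 ≤ t)
    (hE : ErrorBound σ t u v (blockCirc L * (blockCirc M)ᵀ - blockCirc X))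
    (i : Fin I) (j : Fin J) (τ : ZMod n) :
    |(L ∗ₜ Mᵗ - X) i j τ| ≤ 3 * (u * v) * t * σ := by
  obtain ⟨-, -, hp⟩ := h.pair (h.near_of_errorBound ht hE)
  have := hp.abs_apply_le ht ht0 ((opNorm_le_frob _).trans hE.frob_le) (h.left_le (i, τ))
    (h.right_le (j, 0)) (hE.row_le _) (hE.col_le _)
  rw [← blockCirc_tTranspose, ← blockCirc_tProd, ← blockCirc_sub, blockCirc_apply] at this
  simpa using this

/-- The thresholded tensor is `S` minus the low-rank error, whose entries do not exceed the
threshold; threshold plus error gives 3 + 3 = 6. -/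
theorem sparse_step (h : RecoveryData R X S U D V W σ κ u v ρ α) {L : Tensor I R n}
    {M : Tensor J R n} {S' : Tensor I J n} {t : ℝ} (ht : t ≤ 1) (ht0 : 0 ≤ t)
    (hE : ErrorBound σ t u v (blockCirc L * (blockCirc M)ᵀ - blockCirc X))
    (hS : S' = softThreshold (3 * (u * v) * t * σ) (X + S - L ∗ₜ Mᵗ)) (i : Fin I) (j : Fin J)
    (τ : ZMod n) :
    (S i j τ = 0 → S' i j τ = 0) ∧ |(S' - S) i j τ| ≤ 6 * (u * v) * t * σ := by
  have hb := h.abs_error_le ht ht0 hE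
  have e : X + S - L ∗ₜ Mᵗ = S - (L ∗ₜ Mᵗ - X) := by abel
  rw [e] at hS
  have h1 := softThreshold_sub_spec (S := S) hb i j τ
  rw [← hS] at h1
  refine ⟨h1.1, ?_⟩
  have := hb i j τ
  exact h1.2.trans (by linarith)

theorem errorBound_step (h : RecoveryData R X S U D V W σ κ u v ρ α) {L L' : Tensor I R n}
    {M M' : Tensor J R n} {S' : Tensor I J n} {η t : ℝ} (hη : η ∈ Set.Icc (1 / 4 : ℝ) (2 / 3))
    (ht : t ≤ 1) (ht0 : 0 < t)
    (hE : ErrorBound σ t u v (blockCirc L * (blockCirc M)ᵀ - blockCirc X))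
    (hS : S' = softThreshold (3 * (u * v) * t * σ) (X + S - L ∗ₜ Mᵗ))
    (hL : L' = L - η • ((L ∗ₜ Mᵗ + S' - (X + S)) ∗ₜ M ∗ₜ tInv (Mᵗ ∗ₜ M)))
    (hM : M' = M - η • ((L ∗ₜ Mᵗ + S' - (X + S))ᵗ ∗ₜ L ∗ₜ tInv (Lᵗ ∗ₜ L))) :
    ErrorBound σ ((1 - 0.6 * η) * t) u v (blockCirc L' * (blockCirc M')ᵀ - blockCirc X) := by
  have hσ := h.pos
  obtain ⟨iL, iM, hp⟩ := h.pair (h.near_of_errorBound ht hE)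
  have hsp := h.sparse_step ht ht0.le hE hS
  have hsum := h.sparse.sumBound (Z := S' - S) (b := 6 * (t * σ))
    (fun i j τ h0 => by
      rw [Pi.sub_apply, Pi.sub_apply, Pi.sub_apply, (hsp i j τ).1 h0, h0, sub_zero])
    h.u_pos.le h.v_pos.le (by positivity) (fun i j τ => (hsp i j τ).2.trans (by linarith))
    h.u_sq h.v_sq
  have e : blockCirc (L ∗ₜ Mᵗ + S' - (X + S)) =
      blockCirc L * (blockCirc M)ᵀ - blockCirc X + blockCirc (S' - S) := by
    rw [← blockCirc_tTranspose, ← blockCirc_tProd, ← blockCirc_sub, ← blockCirc_add]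
    congr 1
    abel
  rw [blockCirc_update hL hM (tInvertible_gram iL) (tInvertible_gram iM), e]
  refine hp.errorBound_step hη ht ht0 h.u_pos h.v_pos h.left_le h.right_le hE hsum
    (mul_nonneg h.nonneg (by positivity)) h.card_pos ?_
  have h0 : 0 ≤ √(Fintype.card (Fin R × ZMod n)) * (α * n * ρ) :=
    mul_nonneg (Real.sqrt_nonneg _) h.nonneg
  -- After initialization κ is no longer needed and is dropped using κ ≥ 1.
  have h1 : √(Fintype.card (Fin R × ZMod n)) * (α * n * ρ) ≤ 1e-4 :=
    (le_mul_of_one_le_right h0 h.one_le).trans h.small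
  have h2 := mul_le_mul_of_nonneg_right h1 (by positivity : 0 ≤ 6 * (t * σ))
  linarith

end RecoveryData

theorem sqrt_mul_sqrt_div {a : ℝ} (ha : 0 ≤ a) {x : ℝ} (hx : 0 < x) (y : ℝ) :
    √(a / x) * √(a / y) = a / √(x * y) := by
  rw [← Real.sqrt_mul (by positivity), div_mul_div_comm, Real.sqrt_div (by positivity),
    Real.sqrt_mul_self ha]

theorem exists_recoveryData {X S : Tensor I J n} {μ α : ℝ} (hR : 1 ≤ R)
    (hrank : tubalRank X = R) (hfull : ∀ k, multiRank X k = tubalRank X) (hμ : 1 ≤ μ)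
    (hinc : Incoherent R μ X) (hsparse : TSparse α S)
    (hα : α ≤ 1 / (10 ^ 4 * μ * (R : ℝ) ^ (1.5 : ℝ) * (n : ℝ) ^ (1.5 : ℝ) * condNumber X)) :
    ∃ U D V W, RecoveryData R X S U D V W (sigmaMin X) (condNumber X) √(μ * R / I) √(μ * R / J)
      (μ * R) α := by
  obtain ⟨U, D, V, hsvd, hU, hV⟩ := hinc
  have hk : ∀ k, multiRank X k = R := fun k => (hfull k).trans hrank
  obtain ⟨hσ, hle, hmid, W, hW, hW'⟩ := middle_bounds hsvd hk hR
  have hI : 1 ≤ I := by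
    have := rank_le_height (fourierSlice X 0)
    have := hk 0
    rw [multiRank] at this
    omega
  have hJ : 1 ≤ J := by
    have := rank_le_width (fourierSlice X 0)
    have := hk 0
    rw [multiRank] at this
    omega
  have hI' : (0 : ℝ) < I := by exact_mod_cast hI
  have hJ' : (0 : ℝ) < J := by exact_mod_cast hJ
  have hn : (0 : ℝ) < n := Nat.cast_pos.2 (NeZero.pos n)
  have hR' : (0 : ℝ) < R := by exact_mod_cast hR
  have hμ0 : 0 < μ := one_pos.trans_le hμ
  have hκ : 1 ≤ condNumber X := (one_le_div hσ).2 hle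
  -- The sparsity count of an existing slice is nonnegative, which forces the sign of `α`.
  have hα0 : 0 ≤ α := by
    have h1 := (Nat.cast_nonneg _).trans (hsparse.1 ⟨0, hI⟩)
    exact nonneg_of_mul_nonneg_left h1 (by positivity)
  refine ⟨U, D, V, W, ⟨hR, hI, hJ, hσ, hκ, by positivity, by positivity, ?_, ?_, hsvd, hW, hW', ?_,
    fun p => (rowNorm_blockCirc_le U p).trans hU, fun q => (rowNorm_blockCirc_le V q).trans hV,
    hsparse, by positivity, ?_⟩⟩
  · rw [Real.sq_sqrt (by positivity)]; field_simp
  · rw [Real.sq_sqrt (by positivity)]; field_simp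
  · rw [condNumber, div_mul_cancel₀ _ hσ.ne']; exact hmid
  -- The exponents 1.5 arise as √(Rn)·n·μR = μ R^1.5 n^1.5: the root comes from the rank `R * n` of
  -- the block circulant matrix, the rest from the Schur bound.
  · rw [Fintype.card_prod, Fintype.card_fin, ZMod.card, Nat.cast_mul, Real.sqrt_mul hR'.le]
    have p : ∀ x : ℝ, 0 < x → x ^ (1.5 : ℝ) = x * √x := fun x hx => by
      rw [show (1.5 : ℝ) = 1 + 1 / 2 by norm_num, Real.rpow_add hx, Real.rpow_one,
        Real.sqrt_eq_rpow]
    rw [p _ hR', p _ hn, le_div_iff₀ (by positivity)] at hα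
    linarith

end Recovery

end

end RTPCA

/-! ### The recovery theorem. -/

theorem theorem1 (I₁ I₂ I₃ R : ℕ) [NeZero I₃] (hR : 1 ≤ R)
    (Xs Ss : Tensor I₁ I₂ I₃) (μ α ζ₀ η τ : ℝ) (ζ : ℕ → ℝ)
    -- the low-rank tensor
    (hrank : tubalRank Xs = R) (hfull : ∀ k, multiRank Xs k = tubalRank Xs)
    (hμ : 1 ≤ μ) (hinc : Incoherent R μ Xs)
    -- the sparse tensor
    (hsparse : TSparse α Ss)
    (hα : α ≤ 1 / (10 ^ 4 * μ * (R : ℝ) ^ (1.5 : ℝ) * (I₃ : ℝ) ^ (1.5 : ℝ) * condNumber Xs))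
    -- the parameters of the algorithm
    (hζ₀ : infNorm Xs ≤ ζ₀ ∧ ζ₀ ≤ 2 * infNorm Xs) (hζ_zero : ζ 0 = ζ₀)
    (hζ_one : ζ 1 = 3 / √((I₁ : ℝ) * I₂) * μ * R * sigmaMin Xs)
    (hζ_succ : ∀ k, 1 ≤ k → ζ (k + 1) = τ * ζ k)
    (hη : η ∈ Set.Icc (1 / 4 : ℝ) (2 / 3)) (hτ : τ = 1 - 0.6 * η)
    -- the iterates
    (L : ℕ → Tensor I₁ R I₃) (M : ℕ → Tensor I₂ R I₃) (S : ℕ → Tensor I₁ I₂ I₃)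
    (hrun : IsRTPCASGD R (Xs + Ss) ζ η L M S) :
    (∀ k, TInvertible ((L k)ᵗ ∗ₜ L k) ∧ TInvertible ((M k)ᵗ ∗ₜ M k)) ∧
    (∀ k, frobNorm (L k ∗ₜ (M k)ᵗ - Xs) ≤ 0.03 / √(I₃ : ℝ) * τ ^ k * sigmaMin Xs) ∧
    (∀ k, infNorm (L k ∗ₜ (M k)ᵗ - Xs) ≤
      3 / √((I₁ : ℝ) * I₂) * μ * R * τ ^ k * sigmaMin Xs) ∧
    (∀ k, 1 ≤ k → infNorm (S k - Ss) ≤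
      6 / √((I₁ : ℝ) * I₂) * μ * R * τ ^ (k - 1) * sigmaMin Xs) ∧
    (∀ k, supp (S k) ⊆ supp Ss) := by
  obtain ⟨U, D, V, W, h⟩ := exists_recoveryData hR hrank hfull hμ hinc hsparse hα
  set u := √(μ * R / I₁) with hu
  set v := √(μ * R / I₂) with hv
  have hσ := h.pos
  have huv : u * v = μ * R / √((I₁ : ℝ) * I₂) :=
    sqrt_mul_sqrt_div (by positivity) (by exact_mod_cast h.left_pos) _
  have huv3 : ∀ c t : ℝ, c / √((I₁ : ℝ) * I₂) * μ * R * t * sigmaMin Xs =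
      c * (u * v) * t * sigmaMin Xs := fun c t => by rw [huv]; ring
  have hτ0 : 0 < τ := by rw [hτ]; linarith [hη.2]
  have hτ1 : τ ≤ 1 := by rw [hτ]; linarith [hη.1]
  have ht0 : ∀ k, 0 < τ ^ k := fun k => pow_pos hτ0 k
  have ht1 : ∀ k, τ ^ k ≤ 1 := fun k => pow_le_one₀ hτ0.le hτ1
  -- The threshold of step k + 1 is the entrywise error bound of iterate k; hence the exponent k - 1
  -- in the bound for `S k`.
  have hζ : ∀ k, ζ (k + 1) = 3 * (u * v) * τ ^ k * sigmaMin Xs := by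
    intro k
    induction k with
    | zero => rw [← huv3, pow_zero, mul_one, hζ_one]
    | succ k ih => rw [hζ_succ _ (by omega), ih]; ring
  have hstep : ∀ k, S (k + 1) =
      softThreshold (3 * (u * v) * τ ^ k * sigmaMin Xs) (Xs + Ss - L k ∗ₜ (M k)ᵗ) := fun k => by
    rw [hrun.step_sparse, hζ]
  have hE : ∀ k, ErrorBound (sigmaMin Xs) (τ ^ k) u v
      (blockCirc (L k) * (blockCirc (M k)).transpose - blockCirc Xs) := by
    intro k
    induction k with
    | zero =>
      rw [pow_zero]
      exact h.errorBound_zero hζ₀.1 hζ₀.2 (by rw [← hζ_zero]; exact hrun.init_sparse)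
        hrun.init_lowRank
    | succ k ih =>
      rw [pow_succ', hτ]
      rw [hτ] at ih
      exact h.errorBound_step hη (by rw [← hτ]; exact ht1 k) (by rw [← hτ]; exact ht0 k) ih
        (by rw [← hτ]; exact hstep k) (hrun.step_left k) (hrun.step_right k)
  have hsparse_step := fun k => h.sparse_step (ht1 k) (ht0 k).le (hE k) (hstep k)
  refine ⟨fun k => ?_, fun k => ?_, fun k => ?_, fun k hk => ?_, fun k => ?_⟩
  · obtain ⟨iL, iM, -⟩ := h.pair (h.near_of_errorBound (ht1 k) (hE k))
    exact ⟨RecoveryData.tInvertible_gram iL, RecoveryData.tInvertible_gram iM⟩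
  · have h1 := (hE k).frob_le
    rw [← blockCirc_tTranspose, ← blockCirc_tProd, ← blockCirc_sub, frob_blockCirc] at h1
    have hn : 0 < √(I₃ : ℝ) := Real.sqrt_pos.2 (Nat.cast_pos.2 (NeZero.pos I₃))
    rw [div_mul_eq_mul_div, div_mul_eq_mul_div, le_div_iff₀ hn]
    linarith
  · rw [huv3]
    have := ht0 k
    exact infNorm_le (by positivity) (h.abs_error_le (ht1 k) (ht0 k).le (hE k))
  · obtain ⟨k, rfl⟩ : ∃ m, k = m + 1 := ⟨k - 1, by omega⟩
    rw [huv3, Nat.add_sub_cancel]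
    have := ht0 k
    exact infNorm_le (by positivity) fun i j t => (hsparse_step k i j t).2
  · rintro ⟨i, j, t⟩ hS hSs
    cases k with
    | succ k => exact hS ((hsparse_step k i j t).1 hSs)
    | zero =>
      refine hS ?_
      -- For `S 0` the perturbation of `Ss` is all of `Xs`, which ζ₀ dominates.
      have h1 := (softThreshold_sub_spec (S := Ss) (E := -Xs) (z := ζ₀) (fun i j t => by
        rw [Pi.neg_apply, Pi.neg_apply, Pi.neg_apply, abs_neg]
        exact (abs_le_infNorm Xs i j t).trans hζ₀.1) i j t).1 hSs
      rw [sub_neg_eq_add, add_comm] at h1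
      rw [hrun.init_sparse, hζ_zero]
      exact h1
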